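/- Let $(M,g)$ be a smooth Lorentzian manifold (Hausdorff, second countable, without boundary) of dimension $n\ge 3$, with metric signature $(+,-,\dots,-)$, Levi-Civita connection $\nabla$, d'Alembertian $\Box_g=g^{\mu\nu}\nabla_\mu\nabla_\nu$ and volume measure $d\mathrm{Vol}=\sqrt{|\det g|}\,d^nx$. The curvature conventions are the $[-,-,-]$ ones of Misner, Thorne and Wheeler, that is, $R^{\rho}{}_{\sigma\alpha\beta}=-(\partial_\alpha\Gamma^\rho_{\beta\sigma}-\partial_\beta\Gamma^\rho_{\alpha\sigma}+\Gamma^\rho_{\alpha\lambda}\Gamma^\lambda_{\beta\sigma}-\Gamma^\rho_{\beta\lambda}\Gamma^\lambda_{\alpha\sigma})$, $R_{\mu\nu}=R^\rho{}_{\mu\rho\nu}$, $R=g^{\mu\nu}R_{\mu\nu}$, $G_{\mu\nu}=R_{\mu\nu}-\frac12 R\,g_{\mu\nu}$. Let $U$ be a $C^2$ timelike unit vector field on $M$ ($g(U,U)=1$), let $f\in C^2(M,\mathbb R)$ have compact support, and put $V^\mu=fU^\mu$. Let $m\in\mathbb R$ and $\xi\in[0,\xi_v]$ with $\xi_v=\frac{n-3}{2(n-2)}$,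 and let $\phi\in C^2(M,\mathbb R)$ satisfy the field equation $(\Box_g+m^2+\xi R)\phi=0$. Let $$T_{\mu\nu}=(\nabla_\mu\phi)(\nabla_\nu\phi)+\tfrac12 g_{\mu\nu}\big(m^2\phi^2-(\nabla\phi)^2\big)+\xi\,(g_{\mu\nu}\Box_g-\nabla_\mu\nabla_\nu-G_{\mu\nu})\phi^2$$ be the stress-energy tensor of $\phi$, $T=g^{\mu\nu}T_{\mu\nu}$ its trace, and $\rho=T_{\mu\nu}U^\mu U^\nu-\frac{T}{n-2}$ the effective energy density. Then $\rho f^2$ and the integrands of $\mathcal B_1$ and $\mathcal B_2$ below are integrable, and $$\int_M d\mathrm{Vol}\,\rho f^2\ \ge\ -\min\{\mathcal B_1,\mathcal B_2\},$$ where $$\mathcal B_1=\int_M d\mathrm{Vol}\,\Big\{\frac{1-2\xi}{n-2}m^2f^2-\frac{2\xi^2R}{n-2}f^2+\xi\big[(\nabla_\mu V^\mu)^2+(\nabla_\mu V^\nu)(\nabla_\nu V^\mu)\big]\Big\}\phi^2,$$ $$\mathcal B_2=\int_M d\mathrm{Vol}\,\Big\{-\frac{1-2\xi}{2(n-2)}\,\Box_g(f^2)-\frac{\xi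 R}{n-2}f^2+\xi\big[(\nabla_\mu V^\mu)^2+(\nabla_\mu V^\nu)(\nabla_\nu V^\mu)\big]\Big\}\phi^2 .$$ -/

import Mathlib

open MeasureTheory Set
open scoped Manifold ContDiff Matrix

noncomputable section

/-- Coordinate space `ℝⁿ`, the model space of an `n`-dimensional spacetime. -/
abbrev CoordSpace (n : ℕ) : Type := EuclideanSpace ℝ (Fin n)

/-! ### Tensor calculus in a coordinate system

Here `G : ℝⁿ → Matrix` is the matrix of components `g_{ij}` of a metric, `F` is a function in
coordinates and `W` is the list of components of a vector field in coordinates.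
The sign conventions are `[-,-,-]` of Misner, Thorne and Wheeler: the metric has signature
`(+,-,…,-)` and the curvature is
`R^r_{s a b} = -(∂_a Γ^r_{b s} - ∂_b Γ^r_{a s} + Γ^r_{a l} Γ^l_{b s} - Γ^r_{b l} Γ^l_{a s})`,
`R_{ij} = R^r_{i r j}`. -/

namespace Coord

variable {n : ℕ}

/-- The partial derivative `∂_i F` at `y`. -/
def partialDeriv (i : Fin n) (F : CoordSpace n → ℝ) (y : CoordSpace n) : ℝ :=
  fderiv ℝ F y (EuclideanSpace.single i 1)

/-- The Christoffel symbols
`Γ^k_{ij} = 1/2 g^{kl} (∂_i g_{lj} + ∂_j g_{il} - ∂_l g_{ij})` of the Levi-Civita connection. -/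
def christoffel (G : CoordSpace n → Matrix (Fin n) (Fin n) ℝ) (k i j : Fin n)
    (y : CoordSpace n) : ℝ :=
  (1 / 2) * ∑ l, (G y)⁻¹ k l *
    (partialDeriv i (fun z => G z l j) y + partialDeriv j (fun z => G z i l) y
      - partialDeriv l (fun z => G z i j) y)

/-- The Riemann tensor `R^r_{s a b}`. -/
def riemann (G : CoordSpace n → Matrix (Fin n) (Fin n) ℝ) (r s a b : Fin n)
    (y : CoordSpace n) : ℝ :=
  -(partialDeriv a (christoffel G r b s) y - partialDeriv b (christoffel G r a s) y
    + ∑ l, (christoffel G r a l y * christoffel G l b s y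
      - christoffel G r b l y * christoffel G l a s y))

/-- The Ricci tensor `R_{ij} = R^r_{i r j}`. -/
def ricci (G : CoordSpace n → Matrix (Fin n) (Fin n) ℝ) (i j : Fin n) (y : CoordSpace n) : ℝ :=
  ∑ r, riemann G r i r j y

/-- The trace `g^{ij} S_{ij}` at `y` of a symmetric tensor with components `S`. -/
def trace (G : CoordSpace n → Matrix (Fin n) (Fin n) ℝ) (S : Fin n → Fin n → ℝ)
    (y : CoordSpace n) : ℝ :=
  ∑ i, ∑ j, (G y)⁻¹ i j * S i j

/-- The Ricci scalar `R = g^{ij} R_{ij}`. -/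
def scalarCurvature (G : CoordSpace n → Matrix (Fin n) (Fin n) ℝ) (y : CoordSpace n) : ℝ :=
  trace G (fun i j => ricci G i j y) y

/-- The Einstein tensor `G_{ij} = R_{ij} - 1/2 R g_{ij}`. -/
def einstein (G : CoordSpace n → Matrix (Fin n) (Fin n) ℝ) (i j : Fin n)
    (y : CoordSpace n) : ℝ :=
  ricci G i j y - (1 / 2) * scalarCurvature G y * G y i j

/-- The second covariant derivative `∇_i ∇_j F = ∂_i ∂_j F - Γ^k_{ij} ∂_k F` of a function. -/
def hessian (G : CoordSpace n → Matrix (Fin n) (Fin n) ℝ) (F : CoordSpace n → ℝ) (i j : Fin n)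
    (y : CoordSpace n) : ℝ :=
  partialDeriv i (partialDeriv j F) y - ∑ k, christoffel G k i j y * partialDeriv k F y

/-- The d'Alembertian `□ F = g^{ij} ∇_i ∇_j F`. -/
def dAlembertian (G : CoordSpace n → Matrix (Fin n) (Fin n) ℝ) (F : CoordSpace n → ℝ)
    (y : CoordSpace n) : ℝ :=
  trace G (fun i j => hessian G F i j y) y

/-- The square `(∇F)² = g^{ij} (∂_i F) (∂_j F)` of the gradient. -/
def gradSq (G : CoordSpace n → Matrix (Fin n) (Fin n) ℝ) (F : CoordSpace n → ℝ)
    (y : CoordSpace n) : ℝ :=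
  trace G (fun i j => partialDeriv i F y * partialDeriv j F y) y

/-- The covariant derivative `∇_i W^k = ∂_i W^k + Γ^k_{il} W^l` of a vector field. -/
def covDeriv (G : CoordSpace n → Matrix (Fin n) (Fin n) ℝ) (W : CoordSpace n → Fin n → ℝ)
    (i k : Fin n) (y : CoordSpace n) : ℝ :=
  partialDeriv i (fun z => W z k) y + ∑ l, christoffel G k i l y * W y l

/-- The stress-energy tensor of the scalar field `F` of mass `m` and coupling constant `ξ`:
`T_{ij} = (∇_i F)(∇_j F) + 1/2 g_{ij} (m² F² - (∇F)²) + ξ (g_{ij} □ - ∇_i ∇_j - G_{ij}) F²`. -/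
def stressEnergy (G : CoordSpace n → Matrix (Fin n) (Fin n) ℝ) (m ξ : ℝ) (F : CoordSpace n → ℝ)
    (i j : Fin n) (y : CoordSpace n) : ℝ :=
  partialDeriv i F y * partialDeriv j F y
    + (1 / 2) * G y i j * (m ^ 2 * F y ^ 2 - gradSq G F y)
    + ξ * (G y i j * dAlembertian G (fun z => F z ^ 2) y - hessian G (fun z => F z ^ 2) i j y
      - einstein G i j y * F y ^ 2)

end Coord

/-! ### Lorentzian manifolds -/

/-- A smooth Lorentzian metric of signature `(+,-,…,-)` on the `n`-dimensional manifold `M`. -/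
structure LorentzMetric (n : ℕ) (M : Type*) [TopologicalSpace M]
    [ChartedSpace (CoordSpace n) M] [IsManifold (𝓡 n) ∞ M] where
  /-- The bilinear form on each tangent space. -/
  inner (x : M) : TangentSpace (𝓡 n) x →L[ℝ] TangentSpace (𝓡 n) x →L[ℝ] ℝ
  symm (x : M) (v w : TangentSpace (𝓡 n) x) : inner x v w = inner x w v
  /-- There is a timelike vector, and the form is negative definite on its orthogonal
  complement. -/
  signature (x : M) : ∃ v : TangentSpace (𝓡 n) x, 0 < inner x v v ∧
    ∀ w : TangentSpace (𝓡 n) x, inner x v w = 0 → w ≠ 0 → inner x w w < 0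
  contMDiff : ContMDiff (𝓡 n) ((𝓡 n).prod 𝓘(ℝ, CoordSpace n →L[ℝ] CoordSpace n →L[ℝ] ℝ)) ∞
    (fun x : M => Bundle.TotalSpace.mk' (CoordSpace n →L[ℝ] CoordSpace n →L[ℝ] ℝ)
      (E := fun x : M => TangentSpace (𝓡 n) x →L[ℝ] TangentSpace (𝓡 n) x →L[ℝ] ℝ) x (inner x))

namespace LorentzMetric

variable {n : ℕ} {M : Type*} [TopologicalSpace M] [ChartedSpace (CoordSpace n) M]

/-- The coordinate vector `∂/∂x^i` of the chart `e`, at the point with coordinates `y`. -/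
def coordVector (e : OpenPartialHomeomorph M (CoordSpace n)) (y : CoordSpace n) (i : Fin n) :
    TangentSpace (𝓡 n) (e.symm y) :=
  mfderiv (𝓡 n) (𝓡 n) e.symm y (EuclideanSpace.single i (1 : ℝ) : CoordSpace n)

/-- The components in the chart `e` of a vector field `W`. -/
def vectorComponents (e : OpenPartialHomeomorph M (CoordSpace n))
    (W : ∀ x : M, TangentSpace (𝓡 n) x) (y : CoordSpace n) (i : Fin n) : ℝ :=
  (show CoordSpace n from mfderiv (𝓡 n) (𝓡 n) e (e.symm y) (W (e.symm y))) i

variable [IsManifold (𝓡 n) ∞ M] (g : LorentzMetric n M)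

/-- The matrix of components `g_{ij}` of the metric in the chart `e`. -/
def components (e : OpenPartialHomeomorph M (CoordSpace n)) (y : CoordSpace n) :
    Matrix (Fin n) (Fin n) ℝ :=
  Matrix.of fun i j => g.inner (e.symm y) (coordVector e y i) (coordVector e y j)

/-! The scalars below are independent of coordinates; the value at `x` is computed in the
preferred chart around `x`. -/

/-- The Ricci scalar `R` at `x`. -/
def scalarCurvature (x : M) : ℝ :=
  Coord.scalarCurvature (g.components (chartAt (CoordSpace n) x)) (chartAt (CoordSpace n) x x)

/-- The d'Alembertian `□_g φ = g^{μν} ∇_μ ∇_ν φ` at `x`. -/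
def dAlembertian (φ : M → ℝ) (x : M) : ℝ :=
  Coord.dAlembertian (g.components (chartAt (CoordSpace n) x))
    (φ ∘ (chartAt (CoordSpace n) x).symm) (chartAt (CoordSpace n) x x)

/-- The divergence `∇_μ V^μ` at `x`. -/
def divergence (V : ∀ x : M, TangentSpace (𝓡 n) x) (x : M) : ℝ :=
  ∑ i, Coord.covDeriv (g.components (chartAt (CoordSpace n) x))
    (vectorComponents (chartAt (CoordSpace n) x) V) i i (chartAt (CoordSpace n) x x)

/-- The scalar `(∇_μ V^ν) (∇_ν V^μ)` at `x`. -/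
def covDerivTraceSq (V : ∀ x : M, TangentSpace (𝓡 n) x) (x : M) : ℝ :=
  ∑ i, ∑ j,
    Coord.covDeriv (g.components (chartAt (CoordSpace n) x))
      (vectorComponents (chartAt (CoordSpace n) x) V) i j (chartAt (CoordSpace n) x x) *
    Coord.covDeriv (g.components (chartAt (CoordSpace n) x))
      (vectorComponents (chartAt (CoordSpace n) x) V) j i (chartAt (CoordSpace n) x x)

/-- `T_{μν} U^μ U^ν` at `x`, for the stress-energy tensor of the scalar field `φ` of mass `m` and
coupling constant `ξ`. -/
def energyDensity (m ξ : ℝ) (φ : M → ℝ) (U : ∀ x : M, TangentSpace (𝓡 n) x) (x : M) : ℝ :=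
  ∑ i, ∑ j,
    Coord.stressEnergy (g.components (chartAt (CoordSpace n) x)) m ξ
      (φ ∘ (chartAt (CoordSpace n) x).symm) i j (chartAt (CoordSpace n) x x) *
    vectorComponents (chartAt (CoordSpace n) x) U (chartAt (CoordSpace n) x x) i *
    vectorComponents (chartAt (CoordSpace n) x) U (chartAt (CoordSpace n) x x) j

/-- The trace `T = T^μ_μ` at `x` of the stress-energy tensor. -/
def stressEnergyTrace (m ξ : ℝ) (φ : M → ℝ) (x : M) : ℝ :=
  Coord.trace (g.components (chartAt (CoordSpace n) x))
    (fun i j => Coord.stressEnergy (g.components (chartAt (CoordSpace n) x)) m ξ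
      (φ ∘ (chartAt (CoordSpace n) x).symm) i j (chartAt (CoordSpace n) x x))
    (chartAt (CoordSpace n) x x)

/-- The effective energy density `ρ = T_{μν} U^μ U^ν - T / (n - 2)` at `x`. -/
def effectiveEnergyDensity (m ξ : ℝ) (φ : M → ℝ) (U : ∀ x : M, TangentSpace (𝓡 n) x)
    (x : M) : ℝ :=
  g.energyDensity m ξ φ U x - g.stressEnergyTrace m ξ φ x / ((n : ℝ) - 2)

/-- The Klein-Gordon equation `(□_g + m² + ξ R) φ = 0`. -/
def IsOnShell (m ξ : ℝ) (φ : M → ℝ) : Prop :=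
  ∀ x, g.dAlembertian φ x + m ^ 2 * φ x + ξ * g.scalarCurvature x * φ x = 0

variable [MeasurableSpace M]

/-- The measure `√|det g| dx¹ ⋯ dxⁿ` on the domain of the chart `e` (and zero outside it). -/
def chartVolume (e : OpenPartialHomeomorph M (CoordSpace n)) : Measure M :=
  Measure.map e.symm ((volume.restrict e.target).withDensity
    fun y => ENNReal.ofReal (Real.sqrt |(g.components e y).det|))

/-- The volume measure `dVol` of the metric: the least measure that dominates
`√|det g| dx¹ ⋯ dxⁿ` on the domain of each chart of the atlas. As these measures agree on the
overlaps of charts, it restricts to `√|det g| dx¹ ⋯ dxⁿ` on the domain of each chart. -/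
def volumeMeasure : Measure M :=
  ⨆ e ∈ atlas (CoordSpace n) M, g.chartVolume e

end LorentzMetric

end

noncomputable section

namespace Coord

variable {n : ℕ}

/-! ### Partial derivatives -/

/-! Write `N = n - 2` and `ψ = φ²`. In `ρ` the trace removes both `(∇φ)²` and `R`, leaving `(Uφ)² -
m²ψ/N - (ξ/N) □ψ - ξ (∇∇ψ + Ric ψ)(U,U)`. Multiplying by `f²` replaces `U` by `V = fU` in the
quadratic terms. The last bracket is then a divergence up to first-order terms: with `Y = V (Vψ) - ψ
(∇_V V - V div V)`, `div Y = ∇∇ψ(V,V) + Ric(V,V) ψ + 2 (div V)(Vψ) - ψ (tr (∇V)² - (div V)²)`. Here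
the contracted Ricci identity supplies `Ric(V,V)` from the commutator of covariant derivatives on
`V` (`contracted_ricci_identity`, `sum_covDeriv_energyFlux`). The resulting pointwise formula for `ρ
f²` is `effectiveEnergyDensity_mul_sq`.

Let `b₁`, `b₂` be the integrands of the two bounds. Eliminating `ξRφ` by the field equation, using
`□ψ = 2φ□φ + 2(∇φ)²` and completing a square gives `ρf² + b₁ = -ξ div Y + [(1-2ξ)(Vφ)² - (2ξ/N)
f²(∇φ)²] + 2ξ (Vφ + φ div V)²`. For `b₂`, split `-ξ/N = (1-2ξ)/(2N) - 1/(2N)` in front of `f²□ψ` and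
integrate the first part by parts. With `X = f²∇ψ - ψ∇f²` this gives the same identity with `2ξ/N`
replaced by `1/N` and the additional term `(1-2ξ)/(2N) div X`.

Since `U` is unit timelike, `(∇φ)² ≤ (Uφ)²`, so the brackets are nonnegative once `2ξ/N` and `1/N`
are at most `1-2ξ`. The second condition is exactly `ξ ≤ ξ_v` and implies the first. Finally, `div
X` and `div Y` integrate to zero because both fields are `C¹` and supported in the support of `f`
(`integral_divergenceOf`).

The rest of the work connects this with the chart-based definitions. Scalars at `x` are read off in
the preferred chart at `x`, so their continuity and the divergence theorem need chart independence,
which comes from the transformation law of the Christoffel symbols. No transformation law for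
curvature is needed: the Ricci terms in `ρf²` are absorbed into `div Y`, and `R` occurs in `b₁`,
`b₂` only in the product `ξRφ`, which the field equation replaces by continuous functions. -/

theorem partialDeriv_congr {F H : CoordSpace n → ℝ} {s : Set (CoordSpace n)} (hs : IsOpen s)
    (h : EqOn F H s) {y : CoordSpace n} (hy : y ∈ s) (i : Fin n) :
    partialDeriv i F y = partialDeriv i H y := by
  unfold partialDeriv
  rw [Filter.EventuallyEq.fderiv_eq (h.eventuallyEq_of_mem (hs.mem_nhds hy))]

theorem partialDeriv_const (c : ℝ) (i : Fin n) (y : CoordSpace n) :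
    partialDeriv i (fun _ => c) y = 0 := by
  simp [partialDeriv]

theorem partialDeriv_add {F H : CoordSpace n → ℝ} {y : CoordSpace n}
    (hF : DifferentiableAt ℝ F y) (hH : DifferentiableAt ℝ H y) (i : Fin n) :
    partialDeriv i (fun z => F z + H z) y = partialDeriv i F y + partialDeriv i H y := by
  simp [partialDeriv, fderiv_fun_add hF hH]

theorem partialDeriv_sub {F H : CoordSpace n → ℝ} {y : CoordSpace n}
    (hF : DifferentiableAt ℝ F y) (hH : DifferentiableAt ℝ H y) (i : Fin n) :
    partialDeriv i (fun z => F z - H z) y = partialDeriv i F y - partialDeriv i H y := by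
  simp [partialDeriv, fderiv_fun_sub hF hH]

theorem partialDeriv_mul {F H : CoordSpace n → ℝ} {y : CoordSpace n}
    (hF : DifferentiableAt ℝ F y) (hH : DifferentiableAt ℝ H y) (i : Fin n) :
    partialDeriv i (fun z => F z * H z) y
      = partialDeriv i F y * H y + F y * partialDeriv i H y := by
  simp [partialDeriv, fderiv_fun_mul hF hH]
  ring

theorem partialDeriv_pow_two {F : CoordSpace n → ℝ} {y : CoordSpace n}
    (hF : DifferentiableAt ℝ F y) (i : Fin n) :
    partialDeriv i (fun z => F z ^ 2) y = 2 * F y * partialDeriv i F y := by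
  simp only [pow_two]
  rw [partialDeriv_mul hF hF]
  ring

theorem partialDeriv_sum {ι : Type*} {t : Finset ι} {F : ι → CoordSpace n → ℝ}
    {y : CoordSpace n} (hF : ∀ a ∈ t, DifferentiableAt ℝ (F a) y) (i : Fin n) :
    partialDeriv i (fun z => ∑ a ∈ t, F a z) y = ∑ a ∈ t, partialDeriv i (F a) y := by
  simp [partialDeriv, fderiv_fun_sum hF]

theorem fderiv_eq_sum_partialDeriv (F : CoordSpace n → ℝ) (y v : CoordSpace n) :
    fderiv ℝ F y v = ∑ i, v i * partialDeriv i F y := by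
  have hv : v = ∑ i, v i • EuclideanSpace.single i (1 : ℝ) := by
    ext j
    simp [Finset.sum_apply, Pi.single_apply]
  conv_lhs => rw [hv]
  simp [partialDeriv, map_sum]

theorem partialDeriv_comp {F : CoordSpace n → ℝ} {τ : CoordSpace n → CoordSpace n}
    {y : CoordSpace n} (hF : DifferentiableAt ℝ F (τ y)) (hτ : DifferentiableAt ℝ τ y)
    (i : Fin n) :
    partialDeriv i (fun z => F (τ z)) y
      = ∑ c, partialDeriv i (fun z => τ z c) y * partialDeriv c F (τ y) := by
  have h1 : partialDeriv i (fun z => F (τ z)) y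
      = fderiv ℝ F (τ y) (fderiv ℝ τ y (EuclideanSpace.single i 1)) := by
    unfold partialDeriv
    rw [show (fun z => F (τ z)) = F ∘ τ from rfl, fderiv_comp y hF hτ]
    rfl
  have h2 : ∀ c, partialDeriv i (fun z => τ z c) y
      = (fderiv ℝ τ y (EuclideanSpace.single i 1)) c := by
    intro c
    unfold partialDeriv
    have : HasFDerivAt (fun z => τ z c)
        ((EuclideanSpace.proj c : CoordSpace n →L[ℝ] ℝ).comp (fderiv ℝ τ y)) y :=
      (EuclideanSpace.proj c : CoordSpace n →L[ℝ] ℝ).hasFDerivAt.comp y hτ.hasFDerivAt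
    rw [this.fderiv]
    rfl
  rw [h1, fderiv_eq_sum_partialDeriv]
  simp only [h2]

theorem contDiffOn_partialDeriv {F : CoordSpace n → ℝ} {s : Set (CoordSpace n)} (hs : IsOpen s)
    {k l : WithTop ℕ∞} (hF : ContDiffOn ℝ l F s) (hkl : k + 1 ≤ l) (i : Fin n) :
    ContDiffOn ℝ k (partialDeriv i F) s := by
  have := hF.fderiv_of_isOpen hs hkl
  exact this.clm_apply contDiffOn_const

theorem partialDeriv_comm {F : CoordSpace n → ℝ} {s : Set (CoordSpace n)} (hs : IsOpen s)
    (hF : ContDiffOn ℝ 2 F s) {y : CoordSpace n} (hy : y ∈ s) (i j : Fin n) :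
    partialDeriv i (partialDeriv j F) y = partialDeriv j (partialDeriv i F) y := by
  have hc : ContDiffAt ℝ 2 F y := hF.contDiffAt (hs.mem_nhds hy)
  have hd : DifferentiableAt ℝ (fderiv ℝ F) y :=
    (hc.fderiv_right (m := 1) (by norm_num)).differentiableAt (by norm_num)
  have hsymm := hc.isSymmSndFDerivAt (by simp)
  have key : ∀ a b : Fin n, partialDeriv a (partialDeriv b F) y
      = fderiv ℝ (fderiv ℝ F) y (EuclideanSpace.single a 1) (EuclideanSpace.single b 1) := by
    intro a b
    unfold partialDeriv
    rw [fderiv_clm_apply hd (differentiableAt_const _)]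
    simp
  rw [key, key, hsymm]

/-- Jacobi's formula. Differentiating the Leibniz expansion one column at a time gives determinants
with one column replaced by its derivative; Cramer's rule expresses these through the adjugate. -/
theorem partialDeriv_det {G : CoordSpace n → Matrix (Fin n) (Fin n) ℝ} {y : CoordSpace n}
    (hG : ∀ i j, DifferentiableAt ℝ (fun z => G z i j) y) (l : Fin n) :
    partialDeriv l (fun z => (G z).det) y
      = ∑ i, ∑ j, (G y).adjugate i j * partialDeriv l (fun z => G z j i) y := by
  have h1 : HasFDerivAt (fun z => (G z).det) (∑ σ : Equiv.Perm (Fin n),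
      ((Equiv.Perm.sign σ : ℤ) : ℝ) • ∑ i, (∏ j ∈ Finset.univ.erase i, G y (σ j) j) •
        fderiv ℝ (fun z => G z (σ i) i) y) y := by
    simp only [Matrix.det_apply']
    apply HasFDerivAt.fun_sum
    intro σ _
    apply HasFDerivAt.const_mul
    exact HasFDerivAt.finsetProd (fun i _ => (hG (σ i) i).hasFDerivAt)
  have h2 : ∀ i, ∑ j, (G y).adjugate i j * partialDeriv l (fun z => G z j i) y
      = ((G y).updateCol i (fun j => partialDeriv l (fun z => G z j i) y)).det := by
    intro i
    rw [← Matrix.cramer_apply, Matrix.cramer_eq_adjugate_mulVec]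
    rfl
  simp only [h2]
  unfold partialDeriv
  rw [h1.fderiv]
  simp only [Matrix.det_apply', sum_apply, smul_apply,
    smul_eq_mul, Finset.mul_sum]
  rw [Finset.sum_comm]
  refine Finset.sum_congr rfl fun i _ => Finset.sum_congr rfl fun σ _ => ?_
  rw [← Finset.mul_prod_erase Finset.univ _ (Finset.mem_univ i)]
  simp only [Matrix.updateCol_self]
  have : ∏ x ∈ Finset.univ.erase i, G y (σ x) x = ∏ x ∈ Finset.univ.erase i,
      (G y).updateCol i (fun j => fderiv ℝ (fun z => G z j i) y (EuclideanSpace.single l 1))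
        (σ x) x := by
    refine Finset.prod_congr rfl fun x hx => ?_
    rw [Matrix.updateCol_ne (Finset.ne_of_mem_erase hx)]
  rw [this]
  ring

/-! ### Metrics in coordinates -/

/-- `G` is the matrix of components of a smooth nondegenerate metric on the open set `s`. -/
structure IsMetricOn (G : CoordSpace n → Matrix (Fin n) (Fin n) ℝ) (s : Set (CoordSpace n)) :
    Prop where
  isOpen : IsOpen s
  contDiffOn : ∀ i j, ContDiffOn ℝ ∞ (fun z => G z i j) s
  symm : ∀ y ∈ s, ∀ i j, G y i j = G y j i
  det_ne_zero : ∀ y ∈ s, (G y).det ≠ 0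

theorem contDiffOn_det {G : CoordSpace n → Matrix (Fin n) (Fin n) ℝ} {s : Set (CoordSpace n)}
    {k : WithTop ℕ∞} (hG : ∀ i j, ContDiffOn ℝ k (fun z => G z i j) s) :
    ContDiffOn ℝ k (fun z => (G z).det) s := by
  simp only [Matrix.det_apply']
  exact ContDiffOn.sum fun σ _ => contDiffOn_const.mul (contDiffOn_prod fun i _ => hG _ _)

namespace IsMetricOn

variable {G : CoordSpace n → Matrix (Fin n) (Fin n) ℝ} {s : Set (CoordSpace n)}
  {y : CoordSpace n}

section
variable (hG : IsMetricOn G s)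
include hG

theorem mem_nhds (hy : y ∈ s) : s ∈ nhds y := hG.isOpen.mem_nhds hy

theorem contDiffOn_inv (i j : Fin n) : ContDiffOn ℝ ∞ (fun z => (G z)⁻¹ i j) s := by
  have h : ∀ z, (G z)⁻¹ i j = ((G z).det)⁻¹ * ((G z).updateRow j (Pi.single i 1)).det := by
    intro z
    rw [Matrix.inv_def, Matrix.smul_apply, Matrix.adjugate_apply, Ring.inverse_eq_inv', smul_eq_mul]
  simp only [h]
  refine ((contDiffOn_det hG.contDiffOn).inv hG.det_ne_zero).mul (contDiffOn_det fun a b => ?_)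
  by_cases ha : a = j
  · subst ha
    simp only [Matrix.updateRow_self]
    exact contDiffOn_const
  · simp only [Matrix.updateRow_ne ha]
    exact hG.contDiffOn a b

theorem contDiffOn_christoffel (k i j : Fin n) : ContDiffOn ℝ ∞ (christoffel G k i j) s := by
  have hd : ∀ a b c, ContDiffOn ℝ ∞ (fun y => partialDeriv a (fun z => G z b c) y) s :=
    fun a b c => contDiffOn_partialDeriv hG.isOpen (hG.contDiffOn b c) (by simp) a
  exact contDiffOn_const.mul (ContDiffOn.sum fun l _ => (hG.contDiffOn_inv k l).mul
    (((hd _ _ _).add (hd _ _ _)).sub (hd _ _ _)))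

theorem differentiableAt (hy : y ∈ s) (i j : Fin n) :
    DifferentiableAt ℝ (fun z => G z i j) y :=
  ((hG.contDiffOn i j).contDiffAt (hG.mem_nhds hy)).differentiableAt (by simp)

theorem differentiableAt_inv (hy : y ∈ s) (i j : Fin n) :
    DifferentiableAt ℝ (fun z => (G z)⁻¹ i j) y :=
  ((hG.contDiffOn_inv i j).contDiffAt (hG.mem_nhds hy)).differentiableAt (by simp)

theorem differentiableAt_christoffel (hy : y ∈ s) (k i j : Fin n) :
    DifferentiableAt ℝ (christoffel G k i j) y :=
  ((hG.contDiffOn_christoffel k i j).contDiffAt (hG.mem_nhds hy)).differentiableAt (by simp)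

theorem isSymm (hy : y ∈ s) : (G y).IsSymm :=
  Matrix.IsSymm.ext fun i j => hG.symm y hy j i

theorem inv_symm (hy : y ∈ s) (i j : Fin n) : (G y)⁻¹ i j = (G y)⁻¹ j i := by
  have : ((G y)⁻¹)ᵀ = (G y)⁻¹ := by rw [Matrix.transpose_nonsing_inv, (hG.isSymm hy).eq]
  conv_lhs => rw [← this]
  rfl

theorem mul_inv (hy : y ∈ s) : G y * (G y)⁻¹ = 1 :=
  Matrix.mul_nonsing_inv _ (isUnit_iff_ne_zero.2 (hG.det_ne_zero y hy))

theorem inv_mul (hy : y ∈ s) : (G y)⁻¹ * G y = 1 :=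
  Matrix.nonsing_inv_mul _ (isUnit_iff_ne_zero.2 (hG.det_ne_zero y hy))

theorem partialDeriv_symm (hy : y ∈ s) (k i j : Fin n) :
    partialDeriv k (fun z => G z i j) y = partialDeriv k (fun z => G z j i) y :=
  partialDeriv_congr hG.isOpen (fun z hz => hG.symm z hz i j) hy k

theorem christoffel_symm (hy : y ∈ s) (k i j : Fin n) :
    christoffel G k i j y = christoffel G k j i y := by
  unfold christoffel
  congr 1
  refine Finset.sum_congr rfl fun l _ => ?_
  rw [hG.partialDeriv_symm hy i l j, hG.partialDeriv_symm hy j i l, hG.partialDeriv_symm hy l i j]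
  ring

/-- Lowering the upper index of the Christoffel symbols. -/
theorem sum_mul_christoffel (hy : y ∈ s) (m i j : Fin n) :
    ∑ k, G y m k * christoffel G k i j y = (1 / 2) * (partialDeriv i (fun z => G z m j) y
      + partialDeriv j (fun z => G z i m) y - partialDeriv m (fun z => G z i j) y) := by
  have h := congrFun (congrArg (fun A => A *ᵥ (fun l => (1 / 2 : ℝ) *
    (partialDeriv i (fun z => G z l j) y + partialDeriv j (fun z => G z i l) y
      - partialDeriv l (fun z => G z i j) y))) (hG.mul_inv hy)) m
  simp only [Matrix.one_mulVec, ← Matrix.mulVec_mulVec] at h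
  rw [← h]
  simp only [Matrix.mulVec, dotProduct, christoffel]
  refine Finset.sum_congr rfl fun k _ => ?_
  congr 1
  rw [Finset.mul_sum]
  refine Finset.sum_congr rfl fun l _ => ?_
  ring

/-- The Levi-Civita connection is metric. -/
theorem partialDeriv_metric (hy : y ∈ s) (k i j : Fin n) :
    partialDeriv k (fun z => G z i j) y
      = ∑ l, G y i l * christoffel G l k j y + ∑ l, G y j l * christoffel G l k i y := by
  rw [hG.sum_mul_christoffel hy, hG.sum_mul_christoffel hy, hG.partialDeriv_symm hy k j i,
    hG.partialDeriv_symm hy j k i]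
  ring

/-- This is `∇g⁻¹ = 0`. Differentiate `G⁻¹ G = 1` and insert `∂G = GC + (GC)ᵀ`, where `C` is the
matrix of Christoffel symbols with the differentiation index fixed. -/
theorem partialDeriv_inv (hy : y ∈ s) (k i j : Fin n) :
    partialDeriv k (fun z => (G z)⁻¹ i j) y
      = -(∑ l, christoffel G i k l y * (G y)⁻¹ l j) - ∑ l, christoffel G j k l y * (G y)⁻¹ i l := by
  let D : Matrix (Fin n) (Fin n) ℝ := Matrix.of fun a b => partialDeriv k (fun z => G z a b) y
  let E : Matrix (Fin n) (Fin n) ℝ := Matrix.of fun a b => partialDeriv k (fun z => (G z)⁻¹ a b) y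
  let C : Matrix (Fin n) (Fin n) ℝ := Matrix.of fun a b => christoffel G a k b y
  have h1 : E * G y + (G y)⁻¹ * D = 0 := by
    ext a b
    have h := partialDeriv_congr (F := fun z => ∑ c, (G z)⁻¹ a c * G z c b)
      (H := fun _ => (1 : Matrix (Fin n) (Fin n) ℝ) a b) hG.isOpen
      (fun z hz => by rw [← hG.inv_mul hz]; rfl) hy k
    rw [partialDeriv_const, partialDeriv_sum (fun c _ =>
      (hG.differentiableAt_inv hy a c).fun_mul (hG.differentiableAt hy c b))] at h
    simp only [partialDeriv_mul (hG.differentiableAt_inv hy _ _) (hG.differentiableAt hy _ _),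
      Finset.sum_add_distrib] at h
    exact h
  have h2 : D = G y * C + (G y * C)ᵀ := by
    ext a b
    exact hG.partialDeriv_metric hy k a b
  have h3 : E = -(C * (G y)⁻¹) - (C * (G y)⁻¹)ᵀ := by
    have : E = -((G y)⁻¹ * D) * (G y)⁻¹ := by
      rw [← eq_neg_of_add_eq_zero_left h1, Matrix.mul_assoc, hG.mul_inv hy, Matrix.mul_one]
    rw [this, h2, Matrix.mul_add, ← Matrix.mul_assoc, hG.inv_mul hy, Matrix.one_mul,
      Matrix.transpose_mul, Matrix.transpose_mul, Matrix.transpose_nonsing_inv, (hG.isSymm hy).eq,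
      neg_add, Matrix.add_mul, Matrix.neg_mul, Matrix.neg_mul, Matrix.mul_assoc (G y)⁻¹,
      Matrix.mul_assoc Cᵀ, hG.mul_inv hy, Matrix.mul_one, sub_eq_add_neg]
  have h4 := congrFun (congrFun h3 i) j
  simp only [Matrix.sub_apply, Matrix.neg_apply, Matrix.transpose_apply, Matrix.mul_apply] at h4
  change E i j = _
  rw [h4]
  congr 1
  refine Finset.sum_congr rfl fun l _ => ?_
  rw [hG.inv_symm hy l i]
  rfl

/-- The contracted Christoffel symbols. -/
theorem sum_christoffel (hy : y ∈ s) (l : Fin n) :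
    ∑ i, christoffel G i i l y
      = (1 / 2) * ∑ i, ∑ j, (G y)⁻¹ i j * partialDeriv l (fun z => G z j i) y := by
  simp only [christoffel, ← Finset.mul_sum]
  congr 1
  have h : ∑ i, ∑ j, (G y)⁻¹ i j * partialDeriv i (fun z => G z j l) y
      = ∑ i, ∑ j, (G y)⁻¹ i j * partialDeriv j (fun z => G z i l) y := by
    rw [Finset.sum_comm]
    refine Finset.sum_congr rfl fun i _ => Finset.sum_congr rfl fun j _ => ?_
    rw [hG.inv_symm hy]
  simp only [mul_sub, mul_add, Finset.sum_add_distrib, Finset.sum_sub_distrib, h]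
  rw [add_sub_cancel_left]
  refine Finset.sum_congr rfl fun i _ => Finset.sum_congr rfl fun j _ => ?_
  rw [hG.partialDeriv_symm hy l i j]

theorem contDiffOn_sqrt_det : ContDiffOn ℝ ∞ (fun z => √|(G z).det|) s := by
  have h1 := contDiffOn_det hG.contDiffOn
  intro z hz
  have h2 := hG.det_ne_zero z hz
  exact (((contDiffAt_abs h2).comp_contDiffWithinAt z (h1 z hz)).sqrt (by simpa using h2))

theorem partialDeriv_sqrt_det (hy : y ∈ s) (l : Fin n) :
    partialDeriv l (fun z => √|(G z).det|) y = √|(G y).det| * ∑ i, christoffel G i i l y := by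
  have h0 := hG.det_ne_zero y hy
  have hpos : 0 < |(G y).det| := abs_pos.2 h0
  have hs : 0 < √|(G y).det| := Real.sqrt_pos.2 hpos
  have hdet : partialDeriv l (fun z => (G z).det) y = (G y).det * (2 * ∑ i, christoffel G i i l y) := by
    rw [partialDeriv_det (hG.differentiableAt hy), hG.sum_christoffel hy]
    simp only [Matrix.inv_def, Ring.inverse_eq_inv', Matrix.smul_apply, smul_eq_mul,
      Finset.mul_sum]
    refine Finset.sum_congr rfl fun i _ => Finset.sum_congr rfl fun j _ => ?_
    field_simp
  have hd : DifferentiableAt ℝ (fun z => (G z).det) y :=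
    ((contDiffOn_det hG.contDiffOn).contDiffAt (hG.mem_nhds hy)).differentiableAt (by simp)
  have hd' : DifferentiableAt ℝ (fun z => √|(G z).det|) y :=
    (hG.contDiffOn_sqrt_det.contDiffAt (hG.mem_nhds hy)).differentiableAt (by simp)
  -- Differentiating `(√|det G|)⁴ = (det G)²` avoids a case distinction on the sign of the
  -- determinant.
  have h1 : partialDeriv l (fun z => (√|(G z).det|) ^ 2 * (√|(G z).det|) ^ 2) y
      = partialDeriv l (fun z => (G z).det * (G z).det) y := by
    congr 1
    funext z
    rw [Real.sq_sqrt (abs_nonneg _), abs_mul_abs_self]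
  rw [partialDeriv_mul (hd'.fun_pow 2) (hd'.fun_pow 2), partialDeriv_mul hd hd,
    partialDeriv_pow_two hd', hdet, Real.sq_sqrt (abs_nonneg _)] at h1
  have h2 : 4 * √|(G y).det| * |(G y).det| * partialDeriv l (fun z => √|(G z).det|) y
      = 4 * √|(G y).det| * |(G y).det| * (√|(G y).det| * ∑ i, christoffel G i i l y) := by
    have e1 : √|(G y).det| * √|(G y).det| = |(G y).det| := Real.mul_self_sqrt (abs_nonneg _)
    have e2 : |(G y).det| * |(G y).det| = (G y).det * (G y).det := abs_mul_abs_self _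
    linear_combination h1 - 4 * |(G y).det| * (∑ i, christoffel G i i l y) * e1
      - 4 * (∑ i, christoffel G i i l y) * e2
  exact mul_left_cancel₀ (by positivity) h2

end

/-- The covariant divergence as a coordinate divergence of a density. -/
theorem sum_partialDeriv_sqrt_det_mul (hG : IsMetricOn G s) (hy : y ∈ s)
    {W : CoordSpace n → Fin n → ℝ} (hW : ∀ k, DifferentiableAt ℝ (fun z => W z k) y) :
    ∑ i, partialDeriv i (fun z => √|(G z).det| * W z i) y
      = √|(G y).det| * ∑ i, covDeriv G W i i y := by
  have hd : DifferentiableAt ℝ (fun z => √|(G z).det|) y :=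
    (hG.contDiffOn_sqrt_det.contDiffAt (hG.mem_nhds hy)).differentiableAt (by simp)
  simp only [partialDeriv_mul hd (hW _), hG.partialDeriv_sqrt_det hy, covDeriv,
    Finset.sum_add_distrib, mul_add, Finset.mul_sum, Finset.sum_mul]
  rw [add_comm]
  congr 1
  rw [Finset.sum_comm]
  refine Finset.sum_congr rfl fun i _ => Finset.sum_congr rfl fun j _ => ?_
  ring

end IsMetricOn

/-- The components `g^{ij} ∂_j F` of the gradient of a function. -/
def gradient (G : CoordSpace n → Matrix (Fin n) (Fin n) ℝ) (F : CoordSpace n → ℝ)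
    (y : CoordSpace n) (i : Fin n) : ℝ :=
  ∑ j, (G y)⁻¹ i j * partialDeriv j F y

/-- Because the inverse metric is covariantly constant, the divergence passes through it. In
components, one Christoffel term of `∂g⁻¹` cancels the connection term of the divergence and the
other becomes that of the Hessian. -/
theorem IsMetricOn.sum_covDeriv_gradient {G : CoordSpace n → Matrix (Fin n) (Fin n) ℝ}
    {s : Set (CoordSpace n)} {y : CoordSpace n} (hG : IsMetricOn G s) (hy : y ∈ s)
    {F : CoordSpace n → ℝ} (hF : ContDiffOn ℝ 2 F s) :
    ∑ i, covDeriv G (gradient G F) i i y = dAlembertian G F y := by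
  have hd : ∀ j, DifferentiableAt ℝ (partialDeriv j F) y := fun j =>
    ((contDiffOn_partialDeriv (k := 1) hG.isOpen hF (by norm_num) j).contDiffAt
      (hG.mem_nhds hy)).differentiableAt (by norm_num)
  have h : ∀ i, partialDeriv i (fun z => gradient G F z i) y
      = ∑ j, (G y)⁻¹ i j * partialDeriv i (partialDeriv j F) y
        - ∑ j, ∑ l, christoffel G i i l y * (G y)⁻¹ l j * partialDeriv j F y
        - ∑ j, ∑ l, christoffel G j i l y * (G y)⁻¹ i l * partialDeriv j F y := by
    intro i
    unfold gradient
    rw [partialDeriv_sum fun j _ => (hG.differentiableAt_inv hy i j).fun_mul (hd j)]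
    simp only [partialDeriv_mul (hG.differentiableAt_inv hy _ _) (hd _), hG.partialDeriv_inv hy,
      ← Finset.sum_sub_distrib]
    refine Finset.sum_congr rfl fun j _ => ?_
    simp only [← Finset.sum_mul]
    ring
  simp only [covDeriv, h]
  simp only [dAlembertian, trace, hessian, gradient, mul_sub, Finset.mul_sum,
    Finset.sum_add_distrib, Finset.sum_sub_distrib]
  have e1 : ∑ i, ∑ j, ∑ l, christoffel G i i l y * (G y)⁻¹ l j * partialDeriv j F y
      = ∑ i, ∑ l, ∑ j, christoffel G i i l y * ((G y)⁻¹ l j * partialDeriv j F y) := by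
    refine Finset.sum_congr rfl fun i _ => ?_
    rw [Finset.sum_comm]
    simp only [mul_assoc]
  have e2 : ∑ i, ∑ j, ∑ l, christoffel G j i l y * (G y)⁻¹ i l * partialDeriv j F y
      = ∑ i, ∑ l, ∑ j, (G y)⁻¹ i l * (christoffel G j i l y * partialDeriv j F y) := by
    refine Finset.sum_congr rfl fun i _ => ?_
    rw [Finset.sum_comm]
    refine Finset.sum_congr rfl fun i _ => Finset.sum_congr rfl fun j _ => ?_
    ring
  rw [e1, e2]
  ring

/-- The Leibniz rule for the covariant derivative. -/
theorem covDeriv_mul (G : CoordSpace n → Matrix (Fin n) (Fin n) ℝ) {h : CoordSpace n → ℝ}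
    {W : CoordSpace n → Fin n → ℝ} {y : CoordSpace n} (hh : DifferentiableAt ℝ h y)
    (hW : ∀ k, DifferentiableAt ℝ (fun z => W z k) y) (i k : Fin n) :
    covDeriv G (fun z j => h z * W z j) i k y
      = partialDeriv i h y * W y k + h y * covDeriv G W i k y := by
  simp only [covDeriv, partialDeriv_mul hh (hW k), mul_add, Finset.mul_sum]
  rw [add_assoc]
  congr 2
  refine Finset.sum_congr rfl fun l _ => ?_
  ring

theorem covDeriv_add (G : CoordSpace n → Matrix (Fin n) (Fin n) ℝ)
    {W Z : CoordSpace n → Fin n → ℝ} {y : CoordSpace n}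
    (hW : ∀ k, DifferentiableAt ℝ (fun z => W z k) y)
    (hZ : ∀ k, DifferentiableAt ℝ (fun z => Z z k) y) (i k : Fin n) :
    covDeriv G (fun z j => W z j + Z z j) i k y = covDeriv G W i k y + covDeriv G Z i k y := by
  simp only [covDeriv, partialDeriv_add (hW k) (hZ k), mul_add, Finset.sum_add_distrib]
  ring

theorem covDeriv_congr (G : CoordSpace n → Matrix (Fin n) (Fin n) ℝ)
    {W Z : CoordSpace n → Fin n → ℝ} {s : Set (CoordSpace n)} (hs : IsOpen s)
    (h : ∀ z ∈ s, W z = Z z) {y : CoordSpace n} (hy : y ∈ s) (i k : Fin n) :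
    covDeriv G W i k y = covDeriv G Z i k y := by
  unfold covDeriv
  rw [partialDeriv_congr hs (fun z hz => congrFun (h z hz) k) hy i, h y hy]

theorem covDeriv_sum (G : CoordSpace n → Matrix (Fin n) (Fin n) ℝ) {ι : Type*} (t : Finset ι)
    {W : ι → CoordSpace n → Fin n → ℝ} {y : CoordSpace n}
    (hW : ∀ a ∈ t, ∀ k, DifferentiableAt ℝ (fun z => W a z k) y) (i k : Fin n) :
    covDeriv G (fun z j => ∑ a ∈ t, W a z j) i k y = ∑ a ∈ t, covDeriv G (W a) i k y := by
  simp only [covDeriv, partialDeriv_sum (fun a ha => hW a ha k), Finset.sum_add_distrib,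
    Finset.mul_sum]
  rw [Finset.sum_comm]

end Coord

namespace Coord

variable {n : ℕ}

/-! ### Change of coordinates -/

/-- The Jacobian matrix `∂_i τ^a`. -/
def jacobian (τ : CoordSpace n → CoordSpace n) (y : CoordSpace n) : Matrix (Fin n) (Fin n) ℝ :=
  Matrix.of fun a i => partialDeriv i (fun z => τ z a) y

/-- `τ` maps `s` to `s'` and pulls the metric `G'` back to `G`. -/
structure IsIsometryOn (τ : CoordSpace n → CoordSpace n)
    (G G' : CoordSpace n → Matrix (Fin n) (Fin n) ℝ) (s s' : Set (CoordSpace n)) : Prop where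
  source : IsMetricOn G s
  target : IsMetricOn G' s'
  mapsTo : MapsTo τ s s'
  contDiffOn : ContDiffOn ℝ ∞ τ s
  pullback : ∀ y ∈ s, G y = (jacobian τ y)ᵀ * G' (τ y) * jacobian τ y

theorem sum_comm_right {ι : Type*} [Fintype ι] (F : ι → ι → ι → ℝ) :
    ∑ a, ∑ b, ∑ c, F a b c = ∑ a, ∑ c, ∑ b, F a b c :=
  Finset.sum_congr rfl fun _ _ => Finset.sum_comm

namespace IsIsometryOn

variable {τ : CoordSpace n → CoordSpace n} {G G' : CoordSpace n → Matrix (Fin n) (Fin n) ℝ}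
  {s s' : Set (CoordSpace n)} {y : CoordSpace n}

section
variable (h : IsIsometryOn τ G G' s s')
include h

theorem differentiableAt (hy : y ∈ s) : DifferentiableAt ℝ τ y :=
  (h.contDiffOn.contDiffAt (h.source.mem_nhds hy)).differentiableAt (by simp)

theorem contDiffOn_component (a : Fin n) : ContDiffOn ℝ ∞ (fun z => τ z a) s :=
  (EuclideanSpace.proj a : CoordSpace n →L[ℝ] ℝ).contDiff.comp_contDiffOn h.contDiffOn

theorem contDiffOn_jacobian (a i : Fin n) : ContDiffOn ℝ ∞ (fun z => jacobian τ z a i) s :=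
  contDiffOn_partialDeriv h.source.isOpen (h.contDiffOn_component a) (by simp) i

theorem differentiableAt_jacobian (hy : y ∈ s) (a i : Fin n) :
    DifferentiableAt ℝ (fun z => jacobian τ z a i) y :=
  ((h.contDiffOn_jacobian a i).contDiffAt (h.source.mem_nhds hy)).differentiableAt (by simp)

theorem partialDeriv_jacobian_comm (hy : y ∈ s) (a i j : Fin n) :
    partialDeriv i (fun z => jacobian τ z a j) y = partialDeriv j (fun z => jacobian τ z a i) y :=
  partialDeriv_comm h.source.isOpen ((h.contDiffOn_component a).of_le (WithTop.coe_le_coe.2 le_top))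
    hy i j

theorem partialDeriv_comp (hy : y ∈ s) {F : CoordSpace n → ℝ}
    (hF : DifferentiableAt ℝ F (τ y)) (i : Fin n) :
    partialDeriv i (fun z => F (τ z)) y = ∑ c, jacobian τ y c i * partialDeriv c F (τ y) :=
  Coord.partialDeriv_comp hF (h.differentiableAt hy) i

/-- Nondegeneracy of the pulled-back metric forces the Jacobian to be invertible, so no inverse of
`τ` enters the definition of an isometry. -/
theorem det_jacobian_ne_zero (hy : y ∈ s) : (jacobian τ y).det ≠ 0 := by
  intro h0
  apply h.source.det_ne_zero y hy
  rw [h.pullback y hy, Matrix.det_mul, h0, mul_zero]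

/-- The transformation law of the derivatives of the metric. -/
theorem partialDeriv_metric (hy : y ∈ s) (i m j : Fin n) :
    partialDeriv i (fun z => G z m j) y
      = (∑ a, ∑ b, jacobian τ y a j * G' (τ y) a b * partialDeriv i (fun z => jacobian τ z b m) y)
        + (∑ a, ∑ b, ∑ c, jacobian τ y a m * jacobian τ y b j * jacobian τ y c i *
          partialDeriv c (fun z => G' z a b) (τ y))
        + ∑ a, ∑ b, jacobian τ y a m * G' (τ y) a b *
          partialDeriv i (fun z => jacobian τ z b j) y := by
  have hy' := h.mapsTo hy
  have hJ := fun a i => h.differentiableAt_jacobian hy a i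
  have hGτ : ∀ a b, DifferentiableAt ℝ (fun z => G' (τ z) a b) y := fun a b =>
    (h.target.differentiableAt hy' a b).comp y (h.differentiableAt hy)
  have e : partialDeriv i (fun z => G z m j) y = partialDeriv i
      (fun z => ∑ a, ∑ b, jacobian τ z a m * G' (τ z) a b * jacobian τ z b j) y := by
    refine partialDeriv_congr h.source.isOpen (fun z hz => ?_) hy i
    rw [h.pullback z hz]
    simp only [Matrix.mul_apply, Matrix.transpose_apply, Finset.sum_mul]
    exact Finset.sum_comm
  rw [e, partialDeriv_sum fun a _ => DifferentiableAt.fun_sum fun b _ =>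
    ((hJ a m).fun_mul (hGτ a b)).fun_mul (hJ b j)]
  have e2 : ∑ a, ∑ b, jacobian τ y a j * G' (τ y) a b *
      partialDeriv i (fun z => jacobian τ z b m) y = ∑ a, ∑ b,
      partialDeriv i (fun z => jacobian τ z a m) y * G' (τ y) a b * jacobian τ y b j := by
    rw [Finset.sum_comm]
    refine Finset.sum_congr rfl fun a _ => Finset.sum_congr rfl fun b _ => ?_
    rw [h.target.symm _ hy' a b]
    ring
  rw [e2, ← Finset.sum_add_distrib, ← Finset.sum_add_distrib]
  refine Finset.sum_congr rfl fun a _ => ?_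
  rw [partialDeriv_sum fun b _ => ((hJ a m).fun_mul (hGτ a b)).fun_mul (hJ b j),
    ← Finset.sum_add_distrib, ← Finset.sum_add_distrib]
  refine Finset.sum_congr rfl fun b _ => ?_
  rw [partialDeriv_mul ((hJ a m).fun_mul (hGτ a b)) (hJ b j), partialDeriv_mul (hJ a m) (hGτ a b),
    h.partialDeriv_comp hy (h.target.differentiableAt hy' a b), add_mul]
  congr 2
  rw [Finset.mul_sum, Finset.sum_mul]
  refine Finset.sum_congr rfl fun c _ => ?_
  ring

/-- The transformation law of the Christoffel symbols. -/
theorem christoffel_law (hy : y ∈ s) (d i j : Fin n) :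
    ∑ k, jacobian τ y d k * christoffel G k i j y
      = partialDeriv i (fun z => jacobian τ z d j) y
        + ∑ c, ∑ b, christoffel G' d c b (τ y) * jacobian τ y c i * jacobian τ y b j := by
  have hy' := h.mapsTo hy
  set J := jacobian τ y with hJ
  -- Applying the invertible matrix `L` lowers the free index and pulls it back. On the left, `L J =
  -- G` produces Christoffel symbols of the first kind, which involve only derivatives of the
  -- metric.
  let L : Matrix (Fin n) (Fin n) ℝ := Jᵀ * G' (τ y)
  have hL : L.det ≠ 0 := by
    simp only [L, Matrix.det_mul, Matrix.det_transpose]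
    exact mul_ne_zero (h.det_jacobian_ne_zero hy) (h.target.det_ne_zero _ hy')
  have hinj := Matrix.mulVec_injective_iff_isUnit.2
    ((Matrix.isUnit_iff_isUnit_det L).2 (isUnit_iff_ne_zero.2 hL))
  refine congrFun (hinj (a₁ := fun d => ∑ k, J d k * christoffel G k i j y)
    (a₂ := fun d => partialDeriv i (fun z => jacobian τ z d j) y
      + ∑ c, ∑ b, christoffel G' d c b (τ y) * J c i * J b j) ?_) d
  funext m
  have lhs : (L *ᵥ fun d => ∑ k, J d k * christoffel G k i j y) m
      = ∑ k, G y m k * christoffel G k i j y := by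
    have : (fun d => ∑ k, J d k * christoffel G k i j y)
        = J *ᵥ fun k => christoffel G k i j y := rfl
    rw [this, Matrix.mulVec_mulVec, ← h.pullback y hy]
    rfl
  have hLm : ∀ v : Fin n → ℝ, (L *ᵥ v) m = ∑ a, ∑ b, J a m * G' (τ y) a b * v b := by
    intro v
    simp only [L, Matrix.mulVec, dotProduct, Matrix.mul_apply, Matrix.transpose_apply,
      Finset.sum_mul]
    exact Finset.sum_comm
  have low : ∀ a c b, ∑ k, G' (τ y) a k * christoffel G' k c b (τ y) = _ :=
    h.target.sum_mul_christoffel hy'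
  have rhs : ∑ a, ∑ d, J a m * G' (τ y) a d * ∑ c, ∑ b, christoffel G' d c b (τ y) * J c i * J b j
      = ∑ a, ∑ b, ∑ c, J a m * J b j * J c i * ((1 / 2) *
        (partialDeriv c (fun z => G' z a b) (τ y) + partialDeriv b (fun z => G' z c a) (τ y)
          - partialDeriv a (fun z => G' z c b) (τ y))) := by
    refine Finset.sum_congr rfl fun a _ => ?_
    simp only [← low, Finset.mul_sum]
    rw [Finset.sum_congr rfl fun d _ => Finset.sum_comm, Finset.sum_comm]
    refine Finset.sum_congr rfl fun b _ => ?_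
    rw [Finset.sum_comm]
    refine Finset.sum_congr rfl fun c _ => Finset.sum_congr rfl fun d _ => ?_
    ring
  rw [lhs, hLm, h.source.sum_mul_christoffel hy, h.partialDeriv_metric hy,
    h.partialDeriv_metric hy, h.partialDeriv_metric hy]
  simp only [mul_add, Finset.sum_add_distrib]
  rw [rhs]
  -- Symmetry of the second derivatives of `τ`: of the six sums containing them, four cancel in
  -- pairs and the remaining two coincide, absorbing the factor `1/2`.
  simp only [h.partialDeriv_jacobian_comm hy _ j i, h.partialDeriv_jacobian_comm hy _ m i,
    h.partialDeriv_jacobian_comm hy _ m j, ← hJ]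
  have p2 : ∑ a, ∑ b, ∑ c, J a i * J b m * J c j * partialDeriv c (fun z => G' z a b) (τ y)
      = ∑ a, ∑ b, ∑ c, J a m * J b j * J c i * partialDeriv b (fun z => G' z c a) (τ y) := by
    rw [Finset.sum_comm, Finset.sum_congr rfl fun b _ => Finset.sum_comm]
    refine Finset.sum_congr rfl fun a _ => Finset.sum_congr rfl fun b _ =>
      Finset.sum_congr rfl fun c _ => ?_
    ring
  have p3 : ∑ a, ∑ b, ∑ c, J a i * J b j * J c m * partialDeriv c (fun z => G' z a b) (τ y)
      = ∑ a, ∑ b, ∑ c, J a m * J b j * J c i * partialDeriv a (fun z => G' z c b) (τ y) := by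
    rw [sum_comm_right, Finset.sum_comm, Finset.sum_congr rfl fun c _ => Finset.sum_comm]
    refine Finset.sum_congr rfl fun a _ => Finset.sum_congr rfl fun b _ =>
      Finset.sum_congr rfl fun c _ => ?_
    ring
  have p : ∑ a, ∑ b, ∑ c, J a m * J b j * J c i * ((1 / 2) *
        (partialDeriv c (fun z => G' z a b) (τ y) + partialDeriv b (fun z => G' z c a) (τ y)
          - partialDeriv a (fun z => G' z c b) (τ y)))
      = (1 / 2) * ((∑ a, ∑ b, ∑ c, J a m * J b j * J c i *
          partialDeriv c (fun z => G' z a b) (τ y))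
        + (∑ a, ∑ b, ∑ c, J a m * J b j * J c i * partialDeriv b (fun z => G' z c a) (τ y))
        - ∑ a, ∑ b, ∑ c, J a m * J b j * J c i * partialDeriv a (fun z => G' z c b) (τ y)) := by
    simp only [← Finset.sum_add_distrib, ← Finset.sum_sub_distrib, Finset.mul_sum]
    refine Finset.sum_congr rfl fun a _ => Finset.sum_congr rfl fun b _ =>
      Finset.sum_congr rfl fun c _ => ?_
    ring
  rw [p, p2, p3]
  ring

variable {W W' : CoordSpace n → Fin n → ℝ}

/-- The transformation law of the covariant derivative of a vector field. -/
theorem covDeriv_law (hW : ∀ k, DifferentiableOn ℝ (fun z => W z k) s)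
    (hW' : ∀ k, DifferentiableOn ℝ (fun z => W' z k) s')
    (hWW' : ∀ z ∈ s, W' (τ z) = jacobian τ z *ᵥ W z) (hy : y ∈ s) :
    (jacobian τ y)ᵀ * (Matrix.of fun c k => covDeriv G' W' c k (τ y))
      = (Matrix.of fun i k => covDeriv G W i k y) * (jacobian τ y)ᵀ := by
  have hy' := h.mapsTo hy
  have hWy := fun k => (hW k).differentiableAt (h.source.mem_nhds hy)
  have hWy' := fun k => (hW' k).differentiableAt (h.target.mem_nhds hy')
  ext i d
  have e : ∑ c, jacobian τ y c i * partialDeriv c (fun z => W' z d) (τ y)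
      = ∑ k, (partialDeriv i (fun z => jacobian τ z d k) y * W y k
        + jacobian τ y d k * partialDeriv i (fun z => W z k) y) := by
    rw [← h.partialDeriv_comp hy (hWy' d), partialDeriv_congr (H := fun z => ∑ k,
      jacobian τ z d k * W z k) h.source.isOpen (fun z hz => congrFun (hWW' z hz) d) hy,
      partialDeriv_sum fun k _ => (h.differentiableAt_jacobian hy d k).fun_mul (hWy k)]
    exact Finset.sum_congr rfl fun k _ =>
      partialDeriv_mul (h.differentiableAt_jacobian hy d k) (hWy k) i
  simp only [Matrix.mul_apply, Matrix.transpose_apply, Matrix.of_apply, covDeriv, mul_add, add_mul,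
    Finset.sum_add_distrib, hWW' y hy, Matrix.mulVec, dotProduct, e]
  have e1 : ∑ k, (∑ l, christoffel G k i l y * W y l) * jacobian τ y d k
      = ∑ l, (∑ k, jacobian τ y d k * christoffel G k i l y) * W y l := by
    simp only [Finset.sum_mul]
    rw [Finset.sum_comm]
    refine Finset.sum_congr rfl fun a _ => Finset.sum_congr rfl fun b _ => ?_
    ring
  have e2 : ∑ c, jacobian τ y c i * ∑ b, christoffel G' d c b (τ y) * ∑ l, jacobian τ y b l * W y l
      = ∑ l, (∑ c, ∑ b, christoffel G' d c b (τ y) * jacobian τ y c i * jacobian τ y b l)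
        * W y l := by
    simp only [Finset.sum_mul, Finset.mul_sum]
    rw [sum_comm_right, Finset.sum_comm,
      Finset.sum_comm (f := fun l c => ∑ b, christoffel G' d c b (τ y) * _ * _ * _)]
    rw [Finset.sum_comm]
    refine Finset.sum_congr rfl fun a _ => Finset.sum_congr rfl fun b _ =>
      Finset.sum_congr rfl fun c _ => ?_
    ring
  rw [e1, e2]
  -- The inhomogeneous term of `christoffel_law` matches the derivative of the Jacobian produced by
  -- differentiating `W' ∘ τ = J W`.
  simp only [h.christoffel_law hy, add_mul, Finset.sum_add_distrib]
  rw [add_assoc, add_comm, add_assoc, add_comm]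
  have e3 : ∑ k, jacobian τ y d k * partialDeriv i (fun z => W z k) y
      = ∑ k, partialDeriv i (fun z => W z k) y * jacobian τ y d k :=
    Finset.sum_congr rfl fun k _ => mul_comm _ _
  rw [e3]
  ring

/-- In matrix form, `∇W` in two charts differs by conjugation. Its trace and the trace of its square
are therefore invariant, and these are the two scalars of `V` that appear in the bounds. -/
theorem covDeriv_conj (hW : ∀ k, DifferentiableOn ℝ (fun z => W z k) s)
    (hW' : ∀ k, DifferentiableOn ℝ (fun z => W' z k) s')
    (hWW' : ∀ z ∈ s, W' (τ z) = jacobian τ z *ᵥ W z) (hy : y ∈ s) :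
    (Matrix.of fun c k => covDeriv G' W' c k (τ y))
      = ((jacobian τ y)ᵀ)⁻¹ * (Matrix.of fun i k => covDeriv G W i k y) * (jacobian τ y)ᵀ := by
  rw [Matrix.mul_assoc, ← h.covDeriv_law hW hW' hWW' hy, ← Matrix.mul_assoc,
    Matrix.nonsing_inv_mul, Matrix.one_mul]
  rw [Matrix.det_transpose]
  exact isUnit_iff_ne_zero.2 (h.det_jacobian_ne_zero hy)

/-- The divergence of a vector field is independent of coordinates. -/
theorem sum_covDeriv (hW : ∀ k, DifferentiableOn ℝ (fun z => W z k) s)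
    (hW' : ∀ k, DifferentiableOn ℝ (fun z => W' z k) s')
    (hWW' : ∀ z ∈ s, W' (τ z) = jacobian τ z *ᵥ W z) (hy : y ∈ s) :
    ∑ i, covDeriv G' W' i i (τ y) = ∑ i, covDeriv G W i i y := by
  have h1 : IsUnit (jacobian τ y)ᵀ.det := by
    rw [Matrix.det_transpose]; exact isUnit_iff_ne_zero.2 (h.det_jacobian_ne_zero hy)
  have := congrArg Matrix.trace (h.covDeriv_conj hW hW' hWW' hy)
  rwa [Matrix.trace_mul_cycle, Matrix.mul_nonsing_inv _ h1, Matrix.one_mul] at this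

theorem sum_covDeriv_mul_covDeriv (hW : ∀ k, DifferentiableOn ℝ (fun z => W z k) s)
    (hW' : ∀ k, DifferentiableOn ℝ (fun z => W' z k) s')
    (hWW' : ∀ z ∈ s, W' (τ z) = jacobian τ z *ᵥ W z) (hy : y ∈ s) :
    ∑ i, ∑ j, covDeriv G' W' i j (τ y) * covDeriv G' W' j i (τ y)
      = ∑ i, ∑ j, covDeriv G W i j y * covDeriv G W j i y := by
  have h1 : IsUnit (jacobian τ y)ᵀ.det := by
    rw [Matrix.det_transpose]; exact isUnit_iff_ne_zero.2 (h.det_jacobian_ne_zero hy)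
  have h2 := h.covDeriv_conj hW hW' hWW' hy
  have := congrArg Matrix.trace (congrArg₂ (· * ·) h2 h2)
  rw [Matrix.mul_assoc _ (jacobian τ y)ᵀ, ← Matrix.mul_assoc (jacobian τ y)ᵀ,
    ← Matrix.mul_assoc (jacobian τ y)ᵀ, Matrix.mul_nonsing_inv _ h1, Matrix.one_mul,
    ← Matrix.mul_assoc, Matrix.trace_mul_comm _ (jacobian τ y)ᵀ, ← Matrix.mul_assoc,
    ← Matrix.mul_assoc,
    Matrix.mul_nonsing_inv _ h1, Matrix.one_mul] at this
  exact this

/-- The directional derivative of `W` along itself transforms as a vector. -/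
theorem sum_mul_covDeriv (hW : ∀ k, DifferentiableOn ℝ (fun z => W z k) s)
    (hW' : ∀ k, DifferentiableOn ℝ (fun z => W' z k) s')
    (hWW' : ∀ z ∈ s, W' (τ z) = jacobian τ z *ᵥ W z) (hy : y ∈ s) :
    (fun k => ∑ j, W' (τ y) j * covDeriv G' W' j k (τ y))
      = jacobian τ y *ᵥ fun k => ∑ j, W y j * covDeriv G W j k y := by
  change W' (τ y) ᵥ* (Matrix.of fun c k => covDeriv G' W' c k (τ y))
    = jacobian τ y *ᵥ (W y ᵥ* (Matrix.of fun c k => covDeriv G W c k y))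
  rw [hWW' y hy, ← Matrix.vecMul_transpose, Matrix.vecMul_vecMul, h.covDeriv_law hW hW' hWW' hy,
    ← Matrix.vecMul_vecMul, Matrix.vecMul_transpose]

/-- The gradient transforms as a vector. -/
theorem gradient_law {F F' : CoordSpace n → ℝ} (hF' : DifferentiableOn ℝ F' s')
    (hFF' : ∀ z ∈ s, F' (τ z) = F z) (hy : y ∈ s) :
    gradient G' F' (τ y) = jacobian τ y *ᵥ gradient G F y := by
  have hy' := h.mapsTo hy
  have e : (fun i => partialDeriv i F y)
      = (jacobian τ y)ᵀ *ᵥ fun c => partialDeriv c F' (τ y) := by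
    funext i
    rw [← partialDeriv_congr h.source.isOpen hFF' hy i,
      h.partialDeriv_comp hy (hF'.differentiableAt (h.target.mem_nhds hy'))]
    rfl
  change (G' (τ y))⁻¹ *ᵥ _ = jacobian τ y *ᵥ ((G y)⁻¹ *ᵥ fun i => partialDeriv i F y)
  have h1 : IsUnit (jacobian τ y).det := isUnit_iff_ne_zero.2 (h.det_jacobian_ne_zero hy)
  have h2 : IsUnit (jacobian τ y)ᵀ.det := by rwa [Matrix.det_transpose]
  rw [e, h.pullback y hy, Matrix.mul_inv_rev, Matrix.mul_inv_rev, Matrix.mulVec_mulVec,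
    Matrix.mulVec_mulVec, ← Matrix.mul_assoc, ← Matrix.mul_assoc, Matrix.mul_nonsing_inv _ h1,
    Matrix.one_mul, Matrix.mul_assoc, Matrix.nonsing_inv_mul _ h2, Matrix.mul_one]

end

end IsIsometryOn

end Coord

namespace Coord

variable {n : ℕ}

/-! ### The contracted Ricci identity -/

/-- The relabelling needed for the `ΓΓ` part of the curvature in `contracted_ricci_sum`. -/
theorem sum_reverse {ι : Type*} [Fintype ι] (F : ι → ι → ι → ι → ℝ) :
    ∑ a, ∑ b, ∑ c, ∑ d, F a b c d = ∑ d, ∑ c, ∑ b, ∑ a, F a b c d := by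
  simp only [← Fintype.sum_prod_type']
  refine Fintype.sum_equiv ⟨fun p => (((p.2.2.2), p.2.2.1, p.2.1, p.1)),
    fun p => (((p.2.2.2), p.2.2.1, p.2.1, p.1)), fun _ => rfl, fun _ => rfl⟩ _ _ fun _ => rfl

/-- The algebraic content of `contracted_ricci_identity`, for a vector with components `V` and
first derivatives `a i k`, second derivatives `b i j k`, and Christoffel symbols `Γ k i j` with
first derivatives `dΓ i k j l`. -/
theorem contracted_ricci_sum (V : Fin n → ℝ) (a : Fin n → Fin n → ℝ) (Γ : Fin n → Fin n → Fin n → ℝ)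
    (b : Fin n → Fin n → Fin n → ℝ) (dΓ : Fin n → Fin n → Fin n → Fin n → ℝ)
    (A : Fin n → Fin n → ℝ) (hΓ : ∀ k i j, Γ k i j = Γ k j i) (hb : ∀ i j k, b i j k = b j i k)
    (hA : ∀ i k, A i k = a i k + ∑ l, Γ k i l * V l) :
    ∑ i, ((∑ j, (a i j * A j i + V j * (b i j i + ∑ l, (dΓ i i j l * V l + Γ i j l * a i l)))
        - (a i i * (∑ j, A j j)
          + V i * ∑ j, (b i j j + ∑ l, (dΓ i j j l * V l + Γ j j l * a i l))))
        + ∑ l, Γ i i l * ((∑ j, V j * A j l) - V l * ∑ j, A j j))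
      = (∑ i, ∑ j, A i j * A j i) - (∑ i, A i i) ^ 2
        + ∑ i, ∑ j, (∑ r, (dΓ r r j i - dΓ j r r i
          + ∑ l, (Γ r r l * Γ l j i - Γ r j l * Γ l r i))) * V i * V j := by
  -- The second derivatives of `V` cancel by symmetry of `b`. What survives are derivatives and
  -- products of Christoffel symbols, which assemble into the Ricci contraction, and the terms of
  -- `tr A²` and `(tr A)²`.
  have hb' : ∑ i, ∑ j, V j * b i j i = ∑ i, ∑ j, V i * b i j j := by
    rw [Finset.sum_comm]
    exact Finset.sum_congr rfl fun i _ => Finset.sum_congr rfl fun j _ => by rw [hb]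
  have htr : ∑ i, A i i = ∑ i, a i i + ∑ i, ∑ l, Γ i i l * V l := by
    simp only [hA, Finset.sum_add_distrib]
  have hAA : ∑ i, ∑ j, A i j * A j i = (∑ i, ∑ j, a i j * A j i)
      + (∑ i, ∑ j, ∑ l, V j * (Γ i j l * a i l))
      + ∑ i, ∑ j, (∑ l, Γ j i l * V l) * ∑ l, Γ i j l * V l := by
    have e : ∑ i, ∑ j, ∑ l, V j * (Γ i j l * a i l) = ∑ i, ∑ j, (∑ l, Γ j i l * V l) * a j i := by
      rw [Finset.sum_congr rfl fun i _ => Finset.sum_comm, Finset.sum_comm]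
      refine Finset.sum_congr rfl fun i _ => Finset.sum_congr rfl fun j _ => ?_
      rw [Finset.sum_mul]
      refine Finset.sum_congr rfl fun l _ => ?_
      rw [hΓ j l i]
      ring
    rw [e, ← Finset.sum_add_distrib, ← Finset.sum_add_distrib]
    refine Finset.sum_congr rfl fun i _ => ?_
    rw [← Finset.sum_add_distrib, ← Finset.sum_add_distrib]
    refine Finset.sum_congr rfl fun j _ => ?_
    rw [hA i j, hA j i]
    ring
  have hΓV : ∑ i, ∑ l, Γ i i l * ∑ j, V j * A j l
      = (∑ i, ∑ j, ∑ l, V i * (Γ j j l * a i l))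
        + ∑ i, ∑ j, ∑ r, ∑ l, Γ r r l * Γ l j i * V i * V j := by
    have e1 : ∑ i, ∑ j, ∑ l, V i * (Γ j j l * a i l) = ∑ i, ∑ l, ∑ j, Γ i i l * (V j * a j l) := by
      rw [Finset.sum_comm]
      refine Finset.sum_congr rfl fun i _ => ?_
      rw [Finset.sum_comm]
      refine Finset.sum_congr rfl fun l _ => Finset.sum_congr rfl fun j _ => ?_
      ring
    have e2 : ∑ i, ∑ j, ∑ r, ∑ l, Γ r r l * Γ l j i * V i * V j
        = ∑ r, ∑ l, ∑ j, ∑ i, Γ r r l * (V j * (Γ l j i * V i)) := by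
      rw [Finset.sum_comm, Finset.sum_congr rfl fun j _ => Finset.sum_comm, Finset.sum_comm]
      refine Finset.sum_congr rfl fun r _ => ?_
      rw [Finset.sum_congr rfl fun j _ => Finset.sum_comm, Finset.sum_comm]
      refine Finset.sum_congr rfl fun l _ => Finset.sum_congr rfl fun j _ =>
        Finset.sum_congr rfl fun i _ => ?_
      ring
    rw [e1, e2]
    simp only [hA, mul_add, Finset.mul_sum, Finset.sum_add_distrib]
  have hQ : ∑ i, ∑ j, ∑ r, ∑ l, Γ r j l * Γ l r i * V i * V j
      = ∑ i, ∑ j, (∑ l, Γ j i l * V l) * ∑ l, Γ i j l * V l := by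
    have e : ∑ i, ∑ j, (∑ l, Γ j i l * V l) * ∑ l, Γ i j l * V l
        = ∑ i, ∑ j, ∑ k, ∑ l, Γ j i k * V k * (Γ i j l * V l) := by
      simp only [Finset.sum_mul_sum]
    rw [e, sum_reverse]
    refine Finset.sum_congr rfl fun l _ => Finset.sum_congr rfl fun r _ =>
      Finset.sum_congr rfl fun j _ => Finset.sum_congr rfl fun i _ => ?_
    rw [hΓ r j l]
    ring
  have hR : ∑ i, ∑ j, (∑ r, (dΓ r r j i - dΓ j r r i
      + ∑ l, (Γ r r l * Γ l j i - Γ r j l * Γ l r i))) * V i * V j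
      = (∑ i, ∑ j, ∑ l, V j * (dΓ i i j l * V l)) - (∑ i, ∑ j, ∑ l, V i * (dΓ i j j l * V l))
        + (∑ i, ∑ j, ∑ r, ∑ l, Γ r r l * Γ l j i * V i * V j)
        - ∑ i, ∑ j, ∑ r, ∑ l, Γ r j l * Γ l r i * V i * V j := by
    have e1 : ∑ i, ∑ j, ∑ l, V j * (dΓ i i j l * V l) = ∑ i, ∑ j, ∑ r, dΓ r r j i * V i * V j := by
      rw [Finset.sum_congr rfl fun i _ => Finset.sum_comm, Finset.sum_comm]
      refine Finset.sum_congr rfl fun i _ => ?_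
      rw [Finset.sum_comm]
      refine Finset.sum_congr rfl fun j _ => Finset.sum_congr rfl fun r _ => ?_
      ring
    have e2 : ∑ i, ∑ j, ∑ l, V i * (dΓ i j j l * V l) = ∑ i, ∑ j, ∑ r, dΓ j r r i * V i * V j := by
      rw [Finset.sum_congr rfl fun i _ => Finset.sum_comm, Finset.sum_comm]
      refine Finset.sum_congr rfl fun i _ => Finset.sum_congr rfl fun j _ =>
        Finset.sum_congr rfl fun r _ => ?_
      ring
    rw [e1, e2]
    simp only [add_mul, sub_mul, Finset.sum_mul, Finset.sum_add_distrib, Finset.sum_sub_distrib]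
    ring
  rw [hR, hAA, hQ]
  -- The trace is kept opaque, so that distributing the remaining sums does not open it.
  generalize hT : ∑ j, A j j = T at *
  have hL : ∀ i, (∑ j, (a i j * A j i + V j * (b i j i + ∑ l, (dΓ i i j l * V l + Γ i j l * a i l)))
        - (a i i * T + V i * ∑ j, (b i j j + ∑ l, (dΓ i j j l * V l + Γ j j l * a i l))))
        + ∑ l, Γ i i l * ((∑ j, V j * A j l) - V l * T)
      = (∑ j, a i j * A j i) + (∑ j, V j * b i j i) + (∑ j, ∑ l, V j * (dΓ i i j l * V l))
        + (∑ j, ∑ l, V j * (Γ i j l * a i l)) - a i i * T - (∑ j, V i * b i j j)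
        - (∑ j, ∑ l, V i * (dΓ i j j l * V l)) - (∑ j, ∑ l, V i * (Γ j j l * a i l))
        + (∑ l, Γ i i l * ∑ j, V j * A j l) - (∑ l, Γ i i l * V l) * T := by
    intro i
    simp only [mul_add, mul_sub, Finset.sum_add_distrib, Finset.sum_sub_distrib, Finset.mul_sum,
      Finset.sum_mul, mul_assoc]
    ring
  rw [Finset.sum_congr rfl fun i _ => hL i]
  simp only [Finset.sum_add_distrib, Finset.sum_sub_distrib]
  rw [← Finset.sum_mul _ _ T, ← Finset.sum_mul _ _ T, hb', hΓV]
  linear_combination T * htr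

/-- The divergence of `∇_V V - V div V`; the term with two derivatives of `V` is a commutator of
covariant derivatives and gives the Ricci tensor. -/
theorem IsMetricOn.contracted_ricci_identity {G : CoordSpace n → Matrix (Fin n) (Fin n) ℝ}
    {s : Set (CoordSpace n)} {y : CoordSpace n} (hG : IsMetricOn G s) (hy : y ∈ s)
    {V : CoordSpace n → Fin n → ℝ} (hV : ∀ k, ContDiffOn ℝ 2 (fun z => V z k) s) :
    ∑ i, covDeriv G (fun z k => ∑ j, V z j * covDeriv G V j k z - V z k * ∑ j, covDeriv G V j j z)
        i i y
      = (∑ i, ∑ j, covDeriv G V i j y * covDeriv G V j i y) - (∑ i, covDeriv G V i i y) ^ 2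
        - ∑ i, ∑ j, ricci G i j y * V y i * V y j := by
  have hVd : ∀ k, DifferentiableAt ℝ (fun z => V z k) y := fun k =>
    ((hV k).contDiffAt (hG.mem_nhds hy)).differentiableAt (by norm_num)
  have hVdd : ∀ i k, DifferentiableAt ℝ (partialDeriv i (fun z => V z k)) y := fun i k =>
    ((contDiffOn_partialDeriv (k := 1) hG.isOpen (hV k) (by norm_num) i).contDiffAt
      (hG.mem_nhds hy)).differentiableAt (by norm_num)
  have hΓ := hG.differentiableAt_christoffel hy
  have hcov : ∀ j k, DifferentiableAt ℝ (fun z => covDeriv G V j k z) y := fun j k =>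
    (hVdd j k).fun_add (DifferentiableAt.fun_sum fun l _ => (hΓ k j l).fun_mul (hVd l))
  have hdcov : ∀ i j k, partialDeriv i (fun z => covDeriv G V j k z) y
      = partialDeriv i (partialDeriv j (fun z => V z k)) y
        + ∑ l, (partialDeriv i (christoffel G k j l) y * V y l
          + christoffel G k j l y * partialDeriv i (fun z => V z l) y) := by
    intro i j k
    unfold covDeriv
    rw [partialDeriv_add (hVdd j k) (DifferentiableAt.fun_sum fun l _ => (hΓ k j l).fun_mul (hVd l)),
      partialDeriv_sum fun l _ => (hΓ k j l).fun_mul (hVd l)]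
    congr 1
    exact Finset.sum_congr rfl fun l _ => partialDeriv_mul (hΓ k j l) (hVd l) i
  have key := contracted_ricci_sum (V y) (fun i k => partialDeriv i (fun z => V z k) y)
    (fun k i j => christoffel G k i j y)
    (fun i j k => partialDeriv i (partialDeriv j (fun z => V z k)) y)
    (fun i k j l => partialDeriv i (christoffel G k j l) y) (fun i k => covDeriv G V i k y)
    (fun k i j => hG.christoffel_symm hy k i j)
    (fun i j k => partialDeriv_comm hG.isOpen (hV k) hy i j) (fun i k => rfl)
  simp only at key
  -- The overall minus sign of the curvature convention enters here, and it is why `ricci` appears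
  -- with a minus sign in the identity.
  have hric : ∑ i, ∑ j, (∑ r, (partialDeriv r (christoffel G r j i) y
      - partialDeriv j (christoffel G r r i) y + ∑ l, (christoffel G r r l y * christoffel G l j i y
        - christoffel G r j l y * christoffel G l r i y))) * V y i * V y j
      = - ∑ i, ∑ j, ricci G i j y * V y i * V y j := by
    simp only [ricci, riemann, Finset.sum_neg_distrib, neg_mul, neg_neg]
  rw [hric] at key
  rw [sub_eq_add_neg _ (∑ i, ∑ j, ricci G i j y * V y i * V y j), ← key]
  refine Finset.sum_congr rfl fun i _ => ?_
  change partialDeriv i (fun z => (∑ j, V z j * covDeriv G V j i z)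
      - V z i * ∑ j, covDeriv G V j j z) y
    + ∑ l, christoffel G i i l y * ((∑ j, V y j * covDeriv G V j l y)
      - V y l * ∑ j, covDeriv G V j j y) = _
  rw [partialDeriv_sub (DifferentiableAt.fun_sum fun j _ => (hVd j).fun_mul (hcov j i))
    ((hVd i).fun_mul (DifferentiableAt.fun_sum fun j _ => hcov j j)),
    partialDeriv_sum (fun j _ => (hVd j).fun_mul (hcov j i)),
    partialDeriv_mul (hVd i) (DifferentiableAt.fun_sum fun j _ => hcov j j),
    partialDeriv_sum (fun j _ => hcov j j)]
  simp only [partialDeriv_mul (hVd _) (hcov _ _), hdcov]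

end Coord

namespace Coord

variable {n : ℕ}

/-! ### The effective energy density in coordinates -/

/-- The vector field `V (V ψ) - ψ (∇_V V - V div V)`. -/
def energyFlux (G : CoordSpace n → Matrix (Fin n) (Fin n) ℝ) (V : CoordSpace n → Fin n → ℝ)
    (F : CoordSpace n → ℝ) (y : CoordSpace n) (k : Fin n) : ℝ :=
  (∑ j, V y j * partialDeriv j F y) * V y k
    + (-F y) * (∑ j, V y j * covDeriv G V j k y - V y k * ∑ j, covDeriv G V j j y)

section
variable {G : CoordSpace n → Matrix (Fin n) (Fin n) ℝ} {s : Set (CoordSpace n)}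
  {y : CoordSpace n}

namespace IsMetricOn

theorem contDiffOn_covDeriv (hG : IsMetricOn G s) {V : CoordSpace n → Fin n → ℝ}
    (hV : ∀ k, ContDiffOn ℝ 2 (fun z => V z k) s) (i k : Fin n) :
    ContDiffOn ℝ 1 (covDeriv G V i k) s := by
  have h1 : (1 : WithTop ℕ∞) ≤ ∞ := WithTop.coe_le_coe.2 le_top
  exact (contDiffOn_partialDeriv hG.isOpen (hV k) (by norm_num) i).add
    (ContDiffOn.sum fun l _ => ((hG.contDiffOn_christoffel k i l).of_le h1).mul
      ((hV l).of_le (by norm_num)))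

/-- One derivative of the `C²` field `V` is used up, so exactly enough regularity is left to take
the divergence of the flux. -/
theorem contDiffOn_acceleration (hG : IsMetricOn G s) {V : CoordSpace n → Fin n → ℝ}
    (hV : ∀ k, ContDiffOn ℝ 2 (fun z => V z k) s) (k : Fin n) :
    ContDiffOn ℝ 1
      (fun z => ∑ j, V z j * covDeriv G V j k z - V z k * ∑ j, covDeriv G V j j z) s := by
  have hV1 := fun k => (hV k).of_le (m := 1) (by norm_num)
  exact (ContDiffOn.sum fun j _ => (hV1 j).mul (hG.contDiffOn_covDeriv hV j k)).sub
    ((hV1 k).mul (ContDiffOn.sum fun j _ => hG.contDiffOn_covDeriv hV j j))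

theorem contDiffOn_energyFlux (hG : IsMetricOn G s) {V : CoordSpace n → Fin n → ℝ}
    (hV : ∀ k, ContDiffOn ℝ 2 (fun z => V z k) s) {F : CoordSpace n → ℝ}
    (hF : ContDiffOn ℝ 2 F s) (k : Fin n) :
    ContDiffOn ℝ 1 (fun z => energyFlux G V F z k) s := by
  have hV1 := fun k => (hV k).of_le (m := 1) (by norm_num)
  have hF1 := fun j => contDiffOn_partialDeriv (k := 1) hG.isOpen hF (by norm_num) j
  exact ((ContDiffOn.sum fun j _ => (hV1 j).mul (hF1 j)).mul (hV1 k)).add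
    ((hF.of_le (by norm_num)).neg.mul (hG.contDiffOn_acceleration hV k))

theorem contDiffOn_gradient (hG : IsMetricOn G s) {F : CoordSpace n → ℝ}
    (hF : ContDiffOn ℝ 2 F s) (k : Fin n) : ContDiffOn ℝ 1 (fun z => gradient G F z k) s := by
  have h1 : (1 : WithTop ℕ∞) ≤ ∞ := WithTop.coe_le_coe.2 le_top
  exact ContDiffOn.sum fun j _ => ((hG.contDiffOn_inv k j).of_le h1).mul
    (contDiffOn_partialDeriv hG.isOpen hF (by norm_num) j)

/-- By the Leibniz rule, `V(VF) = ∇∇F(V,V) + (∇_V V)F`, and the acceleration term cancels against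
the derivative of `-F` in the flux. The two contributions `(VF) div V` add up, and the divergence of
`∇_V V - V div V` is given by the contracted Ricci identity. -/
theorem sum_covDeriv_energyFlux (hG : IsMetricOn G s) (hy : y ∈ s)
    {V : CoordSpace n → Fin n → ℝ} (hV : ∀ k, ContDiffOn ℝ 2 (fun z => V z k) s)
    {F : CoordSpace n → ℝ} (hF : ContDiffOn ℝ 2 F s) :
    ∑ i, covDeriv G (energyFlux G V F) i i y
      = (∑ i, ∑ j, hessian G F i j y * V y i * V y j)
        + (∑ i, ∑ j, ricci G i j y * V y i * V y j) * F y
        + 2 * (∑ i, covDeriv G V i i y) * (∑ j, V y j * partialDeriv j F y)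
        - F y * ((∑ i, ∑ j, covDeriv G V i j y * covDeriv G V j i y)
          - (∑ i, covDeriv G V i i y) ^ 2) := by
  have hs := hG.mem_nhds hy
  have hVd : ∀ k, DifferentiableAt ℝ (fun z => V z k) y := fun k =>
    ((hV k).contDiffAt hs).differentiableAt (by norm_num)
  have hFd : DifferentiableAt ℝ F y := (hF.contDiffAt hs).differentiableAt (by norm_num)
  have hFdd : ∀ i, DifferentiableAt ℝ (partialDeriv i F) y := fun i =>
    ((contDiffOn_partialDeriv (k := 1) hG.isOpen hF (by norm_num) i).contDiffAt
      hs).differentiableAt (by norm_num)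
  have hZ : ∀ k, DifferentiableAt ℝ
      (fun z => ∑ j, V z j * covDeriv G V j k z - V z k * ∑ j, covDeriv G V j j z) y := fun k =>
    ((hG.contDiffOn_acceleration hV k).contDiffAt hs).differentiableAt (by norm_num)
  have hVF : DifferentiableAt ℝ (fun z => ∑ j, V z j * partialDeriv j F z) y :=
    DifferentiableAt.fun_sum fun j _ => (hVd j).fun_mul (hFdd j)
  have e1 : ∀ i, covDeriv G (energyFlux G V F) i i y
      = (partialDeriv i (fun z => ∑ j, V z j * partialDeriv j F z) y * V y i
          + (∑ j, V y j * partialDeriv j F y) * covDeriv G V i i y)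
        + (-partialDeriv i F y *
            (∑ j, V y j * covDeriv G V j i y - V y i * ∑ j, covDeriv G V j j y)
          + (-F y) * covDeriv G (fun z k => ∑ j, V z j * covDeriv G V j k z
            - V z k * ∑ j, covDeriv G V j j z) i i y) := by
    intro i
    unfold energyFlux
    rw [covDeriv_add G (fun k => hVF.fun_mul (hVd k)) (fun k => hFd.fun_neg.fun_mul (hZ k)),
      covDeriv_mul G hVF hVd, covDeriv_mul G hFd.fun_neg hZ]
    congr 3
    simp [partialDeriv]
  have e2 : ∀ i, partialDeriv i (fun z => ∑ j, V z j * partialDeriv j F z) y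
      = ∑ j, (partialDeriv i (fun z => V z j) y * partialDeriv j F y
        + V y j * partialDeriv i (partialDeriv j F) y) := by
    intro i
    rw [partialDeriv_sum fun j _ => (hVd j).fun_mul (hFdd j)]
    exact Finset.sum_congr rfl fun j _ => partialDeriv_mul (hVd j) (hFdd j) i
  have e3 : (∑ i, partialDeriv i (fun z => ∑ j, V z j * partialDeriv j F z) y * V y i)
      - ∑ i, partialDeriv i F y * ∑ j, V y j * covDeriv G V j i y
      = ∑ i, ∑ j, hessian G F i j y * V y i * V y j := by
    have a1 : ∑ i, partialDeriv i F y * ∑ j, V y j * covDeriv G V j i y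
        = (∑ i, ∑ j, V y i * (partialDeriv i (fun z => V z j) y * partialDeriv j F y))
          + ∑ i, ∑ j, ∑ k, V y i * V y j * (christoffel G k i j y * partialDeriv k F y) := by
      have : ∀ i, ∑ j, ∑ k, V y i * V y j * (christoffel G k i j y * partialDeriv k F y)
          = ∑ k, ∑ j, V y i * V y j * (christoffel G k i j y * partialDeriv k F y) :=
        fun i => Finset.sum_comm
      simp only [this, ← Finset.sum_add_distrib, covDeriv, Finset.mul_sum]
      rw [Finset.sum_comm]
      refine Finset.sum_congr rfl fun i _ => Finset.sum_congr rfl fun j _ => ?_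
      rw [mul_add, mul_add, Finset.mul_sum, Finset.mul_sum]
      congr 1
      · ring
      · exact Finset.sum_congr rfl fun l _ => by ring
    rw [a1]
    simp only [e2, hessian, sub_mul, Finset.sum_add_distrib, Finset.sum_sub_distrib,
      Finset.sum_mul, add_mul]
    have a2 : ∑ i, ∑ j, partialDeriv i (fun z => V z j) y * partialDeriv j F y * V y i
        = ∑ i, ∑ j, V y i * (partialDeriv i (fun z => V z j) y * partialDeriv j F y) :=
      Finset.sum_congr rfl fun i _ => Finset.sum_congr rfl fun j _ => by ring
    have a3 : ∑ i, ∑ j, V y j * partialDeriv i (partialDeriv j F) y * V y i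
        = ∑ i, ∑ j, partialDeriv i (partialDeriv j F) y * V y i * V y j :=
      Finset.sum_congr rfl fun i _ => Finset.sum_congr rfl fun j _ => by ring
    have a4 : ∑ i, ∑ j, ∑ k, V y i * V y j * (christoffel G k i j y * partialDeriv k F y)
        = ∑ i, ∑ j, ∑ k, christoffel G k i j y * partialDeriv k F y * V y i * V y j :=
      Finset.sum_congr rfl fun i _ => Finset.sum_congr rfl fun j _ =>
        Finset.sum_congr rfl fun k _ => by ring
    rw [a2, a3, a4]
    ring
  have e4 : ∑ i, partialDeriv i F y * (V y i * ∑ j, covDeriv G V j j y)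
      = (∑ j, V y j * partialDeriv j F y) * ∑ j, covDeriv G V j j y := by
    rw [Finset.sum_mul]
    exact Finset.sum_congr rfl fun i _ => by ring
  rw [Finset.sum_congr rfl fun i _ => e1 i]
  simp only [Finset.sum_add_distrib, mul_sub, Finset.sum_sub_distrib, neg_mul,
    Finset.sum_neg_distrib]
  rw [← Finset.mul_sum, ← Finset.mul_sum, hG.contracted_ricci_identity hy hV, e4]
  linear_combination e3

theorem sum_inv_mul (hG : IsMetricOn G s) (hy : y ∈ s) :
    ∑ i, ∑ j, (G y)⁻¹ i j * G y i j = n := by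
  have := congrArg Matrix.trace (hG.inv_mul hy)
  rw [Matrix.trace_one, Fintype.card_fin] at this
  rw [← this]
  refine Finset.sum_congr rfl fun i _ => Finset.sum_congr rfl fun j _ => ?_
  rw [hG.symm y hy i j]

/-- The trace of the stress-energy tensor drops out of the effective energy density. -/
theorem effectiveEnergyDensity_eq (hG : IsMetricOn G s) (hy : y ∈ s) (hn : (n : ℝ) - 2 ≠ 0)
    (m ξ : ℝ) (F : CoordSpace n → ℝ) (u : Fin n → ℝ)
    (hu : ∑ i, ∑ j, G y i j * u i * u j = 1) :
    (∑ i, ∑ j, stressEnergy G m ξ F i j y * u i * u j)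
        - trace G (fun i j => stressEnergy G m ξ F i j y) y / ((n : ℝ) - 2)
      = (∑ j, u j * partialDeriv j F y) ^ 2 - m ^ 2 * F y ^ 2 / ((n : ℝ) - 2)
        - ξ / ((n : ℝ) - 2) * dAlembertian G (fun z => F z ^ 2) y
        - ξ * (∑ i, ∑ j, hessian G (fun z => F z ^ 2) i j y * u i * u j)
        - ξ * (∑ i, ∑ j, ricci G i j y * u i * u j) * F y ^ 2 := by
  -- `c` is the coefficient of `g_{ij}` in the stress-energy tensor. It contributes `c` to the
  -- energy density and `n c` to the trace; the net `-2c/(n-2)` cancels `(∇F)²` and the scalar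
  -- curvature against the rest of the trace.
  set c : ℝ := (1 / 2) * (m ^ 2 * F y ^ 2 - gradSq G F y)
    + ξ * dAlembertian G (fun z => F z ^ 2) y + ξ / 2 * scalarCurvature G y * F y ^ 2 with hc
  have hT : ∀ i j, stressEnergy G m ξ F i j y = partialDeriv i F y * partialDeriv j F y
      + c * G y i j - ξ * hessian G (fun z => F z ^ 2) i j y - ξ * F y ^ 2 * ricci G i j y := by
    intro i j
    unfold stressEnergy einstein
    rw [hc]
    ring
  have h1 : ∑ i, ∑ j, stressEnergy G m ξ F i j y * u i * u j
      = (∑ j, u j * partialDeriv j F y) ^ 2 + c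
        - ξ * (∑ i, ∑ j, hessian G (fun z => F z ^ 2) i j y * u i * u j)
        - ξ * F y ^ 2 * (∑ i, ∑ j, ricci G i j y * u i * u j) := by
    rw [← mul_one c, ← hu, pow_two, Finset.sum_mul_sum]
    simp only [Finset.mul_sum, ← Finset.sum_add_distrib, ← Finset.sum_sub_distrib]
    refine Finset.sum_congr rfl fun i _ => Finset.sum_congr rfl fun j _ => ?_
    rw [hT]
    ring
  have h2 : trace G (fun i j => stressEnergy G m ξ F i j y) y
      = gradSq G F y + c * n - ξ * dAlembertian G (fun z => F z ^ 2) y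
        - ξ * F y ^ 2 * scalarCurvature G y := by
    rw [← hG.sum_inv_mul hy]
    simp only [gradSq, dAlembertian, scalarCurvature, trace, Finset.mul_sum,
      ← Finset.sum_add_distrib, ← Finset.sum_sub_distrib]
    refine Finset.sum_congr rfl fun i _ => Finset.sum_congr rfl fun j _ => ?_
    rw [hT]
    ring
  rw [h1, h2, hc]
  field_simp
  ring

theorem dAlembertian_sq (hG : IsMetricOn G s) (hy : y ∈ s) {F : CoordSpace n → ℝ}
    (hF : ContDiffOn ℝ 2 F s) :
    dAlembertian G (fun z => F z ^ 2) y = 2 * F y * dAlembertian G F y + 2 * gradSq G F y := by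
  have hs := hG.mem_nhds hy
  have hFd : ∀ z ∈ s, DifferentiableAt ℝ F z := fun z hz =>
    (hF.contDiffAt (hG.mem_nhds hz)).differentiableAt (by norm_num)
  have hFdd : ∀ i, DifferentiableAt ℝ (partialDeriv i F) y := fun i =>
    ((contDiffOn_partialDeriv (k := 1) hG.isOpen hF (by norm_num) i).contDiffAt
      hs).differentiableAt (by norm_num)
  have hH : ∀ i j, hessian G (fun z => F z ^ 2) i j y
      = 2 * F y * hessian G F i j y + 2 * (partialDeriv i F y * partialDeriv j F y) := by
    intro i j
    have e : partialDeriv i (partialDeriv j fun z => F z ^ 2) y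
        = 2 * partialDeriv i F y * partialDeriv j F y
          + 2 * F y * partialDeriv i (partialDeriv j F) y := by
      rw [partialDeriv_congr hG.isOpen (fun z hz => partialDeriv_pow_two (hFd z hz) j) hy,
        partialDeriv_mul ((hFd y hy).const_mul 2) (hFdd j),
        partialDeriv_mul (differentiableAt_const _) (hFd y hy), partialDeriv_const]
      ring
    simp only [hessian, e, partialDeriv_pow_two (hFd y hy), mul_sub, Finset.mul_sum]
    rw [Finset.sum_congr rfl fun k _ => show christoffel G k i j y * (2 * F y * partialDeriv k F y)
      = 2 * F y * (christoffel G k i j y * partialDeriv k F y) by ring]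
    ring
  simp only [dAlembertian, gradSq, trace, hH, Finset.mul_sum, ← Finset.sum_add_distrib]
  exact Finset.sum_congr rfl fun i _ => Finset.sum_congr rfl fun j _ => by ring

/-- For a unit timelike vector `u`, `(∇F)² ≤ (u F)²`. -/
theorem gradSq_le (hG : IsMetricOn G s) (hy : y ∈ s) (F : CoordSpace n → ℝ) (u : Fin n → ℝ)
    (hu : ∑ i, ∑ j, G y i j * u i * u j = 1)
    (hneg : ∀ w : Fin n → ℝ, ∑ i, ∑ j, G y i j * u i * w j = 0 →
      ∑ i, ∑ j, G y i j * w i * w j ≤ 0) :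
    gradSq G F y ≤ (∑ j, u j * partialDeriv j F y) ^ 2 := by
  have hP : ∀ i, ∑ j, G y i j * gradient G F y j = partialDeriv i F y := by
    intro i
    have : G y *ᵥ ((G y)⁻¹ *ᵥ fun j => partialDeriv j F y) = fun j => partialDeriv j F y := by
      rw [Matrix.mulVec_mulVec, hG.mul_inv hy, Matrix.one_mulVec]
    exact congrFun this i
  set P := gradient G F y with hPdef
  set c := ∑ j, u j * partialDeriv j F y with hc
  have e1 : ∑ i, ∑ j, G y i j * u i * P j = c := by
    rw [hc]
    refine Finset.sum_congr rfl fun i _ => ?_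
    rw [← hP i, Finset.mul_sum]
    exact Finset.sum_congr rfl fun j _ => by ring
  have e1' : ∑ i, ∑ j, G y i j * P i * u j = c := by
    rw [← e1, Finset.sum_comm]
    refine Finset.sum_congr rfl fun i _ => Finset.sum_congr rfl fun j _ => ?_
    rw [hG.symm y hy]
    ring
  have e2 : ∑ i, ∑ j, G y i j * P i * P j = gradSq G F y := by
    have : ∀ i, ∑ j, G y i j * P i * P j = P i * partialDeriv i F y := by
      intro i
      rw [← hP i, Finset.mul_sum]
      exact Finset.sum_congr rfl fun j _ => by ring
    rw [Finset.sum_congr rfl fun i _ => this i]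
    refine Finset.sum_congr rfl fun i _ => ?_
    rw [hPdef, gradient, Finset.sum_mul]
    exact Finset.sum_congr rfl fun j _ => by ring
  -- The gradient `P` has component `c` along `u`. Its projection orthogonal to `u` has nonpositive
  -- square `(∇F)² - c²`.
  have h1 := hneg (fun j => P j - c * u j) (by
    have : ∑ i, ∑ j, G y i j * u i * (P j - c * u j)
        = (∑ i, ∑ j, G y i j * u i * P j) - c * ∑ i, ∑ j, G y i j * u i * u j := by
      simp only [Finset.mul_sum, ← Finset.sum_sub_distrib]
      exact Finset.sum_congr rfl fun i _ => Finset.sum_congr rfl fun j _ => by ring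
    rw [this, e1, hu]
    ring)
  have h2 : ∑ i, ∑ j, G y i j * (P i - c * u i) * (P j - c * u j)
      = (∑ i, ∑ j, G y i j * P i * P j) - c * (∑ i, ∑ j, G y i j * u i * P j)
        - c * (∑ i, ∑ j, G y i j * P i * u j) + c ^ 2 * ∑ i, ∑ j, G y i j * u i * u j := by
    simp only [Finset.mul_sum, ← Finset.sum_sub_distrib, ← Finset.sum_add_distrib]
    exact Finset.sum_congr rfl fun i _ => Finset.sum_congr rfl fun j _ => by ring
  rw [h2, e1, e1', e2, hu] at h1
  linarith

end IsMetricOn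

end

end Coord

/-! ### Charts, transition maps and components of the Lorentzian metric. -/

namespace LorentzMetric

variable {n : ℕ} {M : Type*} [TopologicalSpace M]

section Overlap

variable {e e' : OpenPartialHomeomorph M (CoordSpace n)}

/-- The domain, in the coordinates of `e`, of the transition map from `e` to `e'`. -/
def overlap (e e' : OpenPartialHomeomorph M (CoordSpace n)) : Set (CoordSpace n) :=
  (e.symm.trans e').source

theorem mem_overlap {y : CoordSpace n} :
    y ∈ overlap e e' ↔ y ∈ e.target ∧ e.symm y ∈ e'.source := by
  simp [overlap]

theorem isOpen_overlap : IsOpen (overlap e e') := (e.symm.trans e').open_source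

end Overlap

variable [ChartedSpace (CoordSpace n) M] [IsManifold (𝓡 n) ∞ M]

section Charts

variable {e e' : OpenPartialHomeomorph M (CoordSpace n)}

theorem contMDiffOn_symm (he : e ∈ atlas (CoordSpace n) M) :
    ContMDiffOn (𝓡 n) (𝓡 n) ∞ e.symm e.target :=
  contMDiffOn_symm_of_mem_maximalAtlas (IsManifold.subset_maximalAtlas he)

theorem contMDiffOn_chart (he : e ∈ atlas (CoordSpace n) M) :
    ContMDiffOn (𝓡 n) (𝓡 n) ∞ e e.source :=
  contMDiffOn_of_mem_maximalAtlas (IsManifold.subset_maximalAtlas he)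

theorem chart_mdifferentiable (he : e ∈ atlas (CoordSpace n) M) :
    e.MDifferentiable (𝓡 n) (𝓡 n) := by
  have : IsManifold (𝓡 n) 1 M := IsManifold.of_le (n := ∞) (WithTop.coe_le_coe.2 le_top)
  exact mdifferentiable_of_mem_atlas he

theorem contMDiffOn_transition (he : e ∈ atlas (CoordSpace n) M)
    (he' : e' ∈ atlas (CoordSpace n) M) :
    ContMDiffOn (𝓡 n) (𝓡 n) ∞ (e' ∘ e.symm) (overlap e e') :=
  (contMDiffOn_chart he').comp ((contMDiffOn_symm he).mono fun _ hy => (mem_overlap.1 hy).1)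
    fun _ hy => (mem_overlap.1 hy).2

theorem contDiffOn_transition (he : e ∈ atlas (CoordSpace n) M)
    (he' : e' ∈ atlas (CoordSpace n) M) :
    ContDiffOn ℝ ∞ (e' ∘ e.symm) (overlap e e') :=
  contMDiffOn_iff_contDiffOn.1 (contMDiffOn_transition he he')

theorem mfderiv_symm_eq (he : e ∈ atlas (CoordSpace n) M)
    (he' : e' ∈ atlas (CoordSpace n) M) {y : CoordSpace n} (hy : y ∈ overlap e e')
    (v : CoordSpace n) :
    (mfderiv (𝓡 n) (𝓡 n) e.symm y v : CoordSpace n)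
      = (mfderiv (𝓡 n) (𝓡 n) e'.symm (e' (e.symm y)) (fderiv ℝ (e' ∘ e.symm) y v) : CoordSpace n) := by
  obtain ⟨h1, h2⟩ := mem_overlap.1 hy
  have hτ : MDifferentiableAt (𝓡 n) (𝓡 n) (e' ∘ e.symm) y :=
    ((contMDiffOn_transition he he').contMDiffAt (isOpen_overlap.mem_nhds hy)).mdifferentiableAt
      (by simp)
  have hs : MDifferentiableAt (𝓡 n) (𝓡 n) e'.symm ((e' ∘ e.symm) y) :=
    (chart_mdifferentiable he').mdifferentiableAt_symm (e'.map_source h2)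
  have hc := mfderiv_comp y hs hτ
  have heq : (e'.symm ∘ (e' ∘ e.symm)) =ᶠ[nhds y] e.symm := by
    filter_upwards [isOpen_overlap.mem_nhds hy] with z hz
    exact e'.left_inv (mem_overlap.1 hz).2
  rw [heq.mfderiv_eq] at hc
  have := congrArg (fun L => (L v : CoordSpace n)) hc
  simp only [mfderiv_eq_fderiv] at this
  exact this

theorem mfderiv_symm_mfderiv_chart (he : e ∈ atlas (CoordSpace n) M) {y : CoordSpace n}
    (hy : y ∈ e.target) (v : TangentSpace (𝓡 n) (e.symm y)) :
    mfderiv (𝓡 n) (𝓡 n) e.symm y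
      (mfderiv (𝓡 n) (𝓡 n) e (e.symm y) v : CoordSpace n) = v := by
  have h := (chart_mdifferentiable he).symm_comp_deriv (e.map_target hy)
  have h3 := congrArg (fun L => L v) h
  rw [e.right_inv hy] at h3
  exact h3

theorem mfderiv_chart_mfderiv_symm (he : e ∈ atlas (CoordSpace n) M) {y : CoordSpace n}
    (hy : y ∈ e.target) (v : CoordSpace n) :
    (mfderiv (𝓡 n) (𝓡 n) e (e.symm y) (mfderiv (𝓡 n) (𝓡 n) e.symm y v) : CoordSpace n) = v :=
  congrArg (fun L => (L v : CoordSpace n)) ((chart_mdifferentiable he).comp_symm_deriv hy)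

theorem mfderiv_chart_eq (he : e ∈ atlas (CoordSpace n) M)
    (he' : e' ∈ atlas (CoordSpace n) M) {y : CoordSpace n} (hy : y ∈ overlap e e')
    (v : TangentSpace (𝓡 n) (e.symm y)) :
    (mfderiv (𝓡 n) (𝓡 n) e' (e.symm y) v : CoordSpace n)
      = fderiv ℝ (e' ∘ e.symm) y (mfderiv (𝓡 n) (𝓡 n) e (e.symm y) v : CoordSpace n) := by
  obtain ⟨h1, h2⟩ := mem_overlap.1 hy
  have hc := mfderiv_comp y ((chart_mdifferentiable he').mdifferentiableAt h2)
    ((chart_mdifferentiable he).mdifferentiableAt_symm h1)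
  rw [← mfderiv_eq_fderiv, hc]
  conv_lhs => rw [← mfderiv_symm_mfderiv_chart he h1 v]
  rfl

theorem fderiv_apply_eq_mulVec (he : e ∈ atlas (CoordSpace n) M)
    (he' : e' ∈ atlas (CoordSpace n) M) {y : CoordSpace n} (hy : y ∈ overlap e e')
    (v : CoordSpace n) (a : Fin n) :
    (fderiv ℝ (e' ∘ e.symm) y v) a = (Coord.jacobian (e' ∘ e.symm) y *ᵥ fun i => v i) a := by
  have hτ : DifferentiableAt ℝ (e' ∘ e.symm) y :=
    ((contDiffOn_transition he he').contDiffAt (isOpen_overlap.mem_nhds hy)).differentiableAt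
      (by simp)
  have h2 : fderiv ℝ (fun z => (e' ∘ e.symm) z a) y
      = (EuclideanSpace.proj a : CoordSpace n →L[ℝ] ℝ).comp (fderiv ℝ (e' ∘ e.symm) y) :=
    ((EuclideanSpace.proj a : CoordSpace n →L[ℝ] ℝ).hasFDerivAt.comp y hτ.hasFDerivAt).fderiv
  have h3 := Coord.fderiv_eq_sum_partialDeriv (fun z => (e' ∘ e.symm) z a) y v
  rw [h2] at h3
  refine h3.trans (Finset.sum_congr rfl fun i _ => mul_comm _ _)

/-- The components of a vector field transform with the Jacobian matrix. -/
theorem vectorComponents_transition (he : e ∈ atlas (CoordSpace n) M)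
    (he' : e' ∈ atlas (CoordSpace n) M) (W : ∀ x : M, TangentSpace (𝓡 n) x) {y : CoordSpace n}
    (hy : y ∈ overlap e e') :
    vectorComponents e' W ((e' ∘ e.symm) y)
      = Coord.jacobian (e' ∘ e.symm) y *ᵥ vectorComponents e W y := by
  funext a
  have h2 := (mem_overlap.1 hy).2
  have h3 : vectorComponents e' W ((e' ∘ e.symm) y) a
      = (show CoordSpace n from mfderiv (𝓡 n) (𝓡 n) e' (e.symm y) (W (e.symm y))) a := by
    unfold vectorComponents
    rw [Function.comp_apply, e'.left_inv h2]
  rw [h3]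
  exact (congrArg (fun v : CoordSpace n => v a) (mfderiv_chart_eq he he' hy _)).trans
    (fderiv_apply_eq_mulVec he he' hy _ a)

/-- A coordinate field is the image of a constant field under the tangent map of the inverse chart;
its smoothness is what makes the metric components smooth. -/
theorem contMDiffOn_coordVector (he : e ∈ atlas (CoordSpace n) M) (i : Fin n) :
    ContMDiffOn (𝓡 n) (𝓡 n).tangent ∞
      (fun y => (⟨e.symm y, coordVector e y i⟩ : TangentBundle (𝓡 n) M)) e.target := by
  have : IsManifold (𝓡 n) 1 M := IsManifold.of_le (n := ∞) (WithTop.coe_le_coe.2 le_top)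
  have h1 := (contMDiffOn_symm he).contMDiffOn_tangentMapWithin (m := ∞) (by simp)
    e.open_target.uniqueMDiffOn
  have h2 : ContMDiffOn (𝓡 n) (𝓡 n).tangent ∞
      (fun y => (⟨y, EuclideanSpace.single i (1 : ℝ)⟩ : TangentBundle (𝓡 n) (CoordSpace n)))
      e.target :=
    contMDiffOn_vectorSpace_iff_contDiffOn.2 contDiffOn_const
  refine (h1.comp h2 fun y hy => hy).congr fun y hy => ?_
  simp only [Function.comp_apply, tangentMapWithin, coordVector]
  rw [mfderivWithin_of_isOpen e.open_target hy]

theorem contDiffOn_vectorComponents (he : e ∈ atlas (CoordSpace n) M)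
    {W : ∀ x : M, TangentSpace (𝓡 n) x} {k : ℕ∞}
    (hW : ContMDiff (𝓡 n) (𝓡 n).tangent k (fun x => (⟨x, W x⟩ : TangentBundle (𝓡 n) M)))
    (i : Fin n) : ContDiffOn ℝ k (fun y => vectorComponents e W y i) e.target := by
  have : IsManifold (𝓡 n) 1 M := IsManifold.of_le (n := ∞) (WithTop.coe_le_coe.2 le_top)
  have hk : (k : WithTop ℕ∞) ≤ ∞ := WithTop.coe_le_coe.2 le_top
  have h1 := (contMDiffOn_chart he).contMDiffOn_tangentMapWithin (m := k)
    ((add_le_add_left hk 1).trans (by simp)) e.open_source.uniqueMDiffOn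
  have h2 := hW.comp_contMDiffOn ((contMDiffOn_symm he).of_le hk)
  have h3 := (contMDiff_snd_tangentBundle_modelSpace (CoordSpace n) (𝓡 n) (n := k)).comp_contMDiffOn
    (h1.comp h2 fun y hy => e.map_target hy)
  have h4 := contMDiffOn_iff_contDiffOn.1 h3
  refine ((EuclideanSpace.proj i : CoordSpace n →L[ℝ] ℝ).contDiff.comp_contDiffOn h4).congr
    fun y hy => ?_
  have h5 := mfderivWithin_of_isOpen (I := 𝓡 n) (I' := 𝓡 n) (f := e) e.open_source
    (e.map_target hy)
  exact congrArg (fun L => (show CoordSpace n from L (W (e.symm y))) i) h5.symm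

end Charts

section Metric

variable (g : LorentzMetric n M) {e e' : OpenPartialHomeomorph M (CoordSpace n)}

theorem inner_mfderiv_symm (y u w : CoordSpace n) :
    g.inner (e.symm y) (mfderiv (𝓡 n) (𝓡 n) e.symm y u) (mfderiv (𝓡 n) (𝓡 n) e.symm y w)
      = ∑ i, ∑ j, g.components e y i j * u i * w j := by
  have hv : ∀ v : CoordSpace n, (mfderiv (𝓡 n) (𝓡 n) e.symm y v)
      = ∑ i, v i • coordVector e y i := by
    intro v
    have : v = ∑ i, v i • EuclideanSpace.single i (1 : ℝ) := by
      ext j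
      simp [Finset.sum_apply, Pi.single_apply]
    conv_lhs => rw [this]
    exact (map_sum (mfderiv (𝓡 n) (𝓡 n) e.symm y) _ _).trans
      (Finset.sum_congr rfl fun i _ => map_smul _ _ _)
  rw [hv u, hv w]
  simp only [map_sum, map_smul, FunLike.coe_sum, Finset.sum_apply,
    FunLike.coe_smul, Pi.smul_apply, smul_eq_mul, components, Matrix.of_apply,
    Finset.mul_sum]
  rw [Finset.sum_comm]
  exact Finset.sum_congr rfl fun i _ => Finset.sum_congr rfl fun j _ => by ring

theorem exists_mfderiv_symm_eq (he : e ∈ atlas (CoordSpace n) M) {y : CoordSpace n}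
    (hy : y ∈ e.target) (W : ∀ x : M, TangentSpace (𝓡 n) x) :
    ∃ u : CoordSpace n, mfderiv (𝓡 n) (𝓡 n) e.symm y u = W (e.symm y) ∧
      ∀ i, u i = vectorComponents e W y i :=
  ⟨_, mfderiv_symm_mfderiv_chart he hy (W (e.symm y)), fun _ => rfl⟩

theorem inner_eq_sum (he : e ∈ atlas (CoordSpace n) M) {y : CoordSpace n} (hy : y ∈ e.target)
    (V W : ∀ x : M, TangentSpace (𝓡 n) x) :
    g.inner (e.symm y) (V (e.symm y)) (W (e.symm y)) = ∑ i, ∑ j, g.components e y i j *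
      vectorComponents e V y i * vectorComponents e W y j := by
  obtain ⟨v, hv, hv'⟩ := exists_mfderiv_symm_eq he hy V
  obtain ⟨w, hw, hw'⟩ := exists_mfderiv_symm_eq he hy W
  rw [← hv, ← hw, inner_mfderiv_symm]
  simp only [hv', hw']

/-- The form is negative semidefinite on the orthogonal complement of every timelike vector. -/
theorem inner_self_nonpos {x : M} {u w : TangentSpace (𝓡 n) x} (hu : 0 < g.inner x u u)
    (huw : g.inner x u w = 0) : g.inner x w w ≤ 0 := by
  obtain ⟨v, hv, hneg⟩ := g.signature x
  by_contra! hw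
  have hwu : g.inner x w u = 0 := by rw [g.symm, huw]
  set a := g.inner x v w with ha
  set b := g.inner x v u with hb
  -- If `u` and `w` were orthogonal with positive squares, the plane they span would meet the
  -- complement of `v`, where the form is negative definite. The combination `a u - b w` lies in
  -- that intersection and has positive square if `b ≠ 0`; if `b = 0`, then `u` itself lies there.
  have h1 : g.inner x v (a • u - b • w) = 0 := by
    simp only [map_sub, map_smul, smul_eq_mul, ← ha, ← hb]
    ring
  have h2 : g.inner x (a • u - b • w) (a • u - b • w)
      = a ^ 2 * g.inner x u u + b ^ 2 * g.inner x w w := by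
    simp only [map_sub, map_smul, smul_eq_mul, sub_apply, smul_apply, huw, hwu]
    ring
  by_cases hb0 : b = 0
  · have hu0 : u ≠ 0 := by
      rintro rfl
      simp at hu
    exact absurd (hneg u hb0 hu0) (not_lt.2 hu.le)
  · have hpos : 0 < g.inner x (a • u - b • w) (a • u - b • w) := by
      rw [h2]
      positivity
    by_cases hz : a • u - b • w = 0
    · rw [hz] at hpos
      simp at hpos
    · exact absurd (hneg _ h1 hz) (not_lt.2 hpos.le)

theorem eq_zero_of_inner_eq_zero {x : M} {w : TangentSpace (𝓡 n) x}
    (hw : ∀ v, g.inner x v w = 0) : w = 0 := by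
  obtain ⟨v, hv, hneg⟩ := g.signature x
  by_contra h
  exact absurd (hneg w (hw v) h) (by rw [hw w]; exact lt_irrefl 0)

/-- Smoothness comes from evaluating the smooth section `g` on coordinate fields. A kernel vector of
the component matrix would be a tangent vector orthogonal to everything, which the signature rules
out. -/
theorem isMetricOn_components (he : e ∈ atlas (CoordSpace n) M) :
    Coord.IsMetricOn (g.components e) e.target where
  isOpen := e.open_target
  contDiffOn i j := by
    have h1 : ContMDiffOn (𝓡 n) ((𝓡 n).prod 𝓘(ℝ)) ∞
        (fun y => Bundle.TotalSpace.mk' ℝ (E := Bundle.Trivial M ℝ) (e.symm y)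
          (g.inner (e.symm y) (coordVector e y i) (coordVector e y j))) e.target := by
      apply ContMDiffOn.clm_bundle_apply₂ (F₁ := CoordSpace n) (F₂ := CoordSpace n)
      · exact g.contMDiff.comp_contMDiffOn (contMDiffOn_symm he)
      · exact contMDiffOn_coordVector he i
      · exact contMDiffOn_coordVector he j
    intro y hy
    have h2 := h1 y hy
    simp only [Bundle.contMDiffWithinAt_totalSpace] at h2
    exact contMDiffWithinAt_iff_contDiffWithinAt.1 h2.2
  symm y _ i j := g.symm _ _ _
  det_ne_zero y hy := by
    intro h0
    obtain ⟨c, hc, hc0⟩ := Matrix.exists_mulVec_eq_zero_iff.2 h0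
    apply hc
    have h1 : mfderiv (𝓡 n) (𝓡 n) e.symm y (WithLp.toLp 2 c : CoordSpace n) = 0 := by
      refine g.eq_zero_of_inner_eq_zero fun v => ?_
      obtain ⟨u, rfl⟩ : ∃ u : CoordSpace n, mfderiv (𝓡 n) (𝓡 n) e.symm y u = v :=
        ⟨_, mfderiv_symm_mfderiv_chart he hy v⟩
      rw [inner_mfderiv_symm]
      refine Finset.sum_eq_zero fun i _ => ?_
      have := congrFun hc0 i
      simp only [Matrix.mulVec, dotProduct, Pi.zero_apply] at this
      rw [← mul_zero (u i), ← this,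
        Finset.mul_sum]
      exact Finset.sum_congr rfl fun j _ => by ring
    have h2 := mfderiv_chart_mfderiv_symm he hy (WithLp.toLp 2 c : CoordSpace n)
    rw [h1] at h2
    have h3 : (WithLp.toLp 2 c : CoordSpace n) = 0 := by
      rw [← h2]
      exact map_zero _
    funext i
    exact congrArg (fun v : CoordSpace n => v i) h3

/-- The transition maps pull the components of the metric back to each other. -/
theorem isIsometryOn_transition (he : e ∈ atlas (CoordSpace n) M)
    (he' : e' ∈ atlas (CoordSpace n) M) :
    Coord.IsIsometryOn (e' ∘ e.symm) (g.components e) (g.components e') (overlap e e')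
      e'.target where
  source :=
    { isOpen := isOpen_overlap
      contDiffOn := fun i j => ((g.isMetricOn_components he).contDiffOn i j).mono
        fun _ hy => (mem_overlap.1 hy).1
      symm := fun y hy => (g.isMetricOn_components he).symm y (mem_overlap.1 hy).1
      det_ne_zero := fun y hy => (g.isMetricOn_components he).det_ne_zero y (mem_overlap.1 hy).1 }
  target := g.isMetricOn_components he'
  mapsTo _ hy := e'.map_source (mem_overlap.1 hy).2
  contDiffOn := contDiffOn_transition he he'
  pullback y hy := by
    have h2 := (mem_overlap.1 hy).2
    ext i j
    have h3 : ∀ v w : CoordSpace n,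
        g.inner (e.symm y) (mfderiv (𝓡 n) (𝓡 n) e.symm y v) (mfderiv (𝓡 n) (𝓡 n) e.symm y w)
        = ∑ a, ∑ b, g.components e' (e' (e.symm y)) a b * (fderiv ℝ (e' ∘ e.symm) y v) a
          * (fderiv ℝ (e' ∘ e.symm) y w) b := by
      intro v w
      rw [← inner_mfderiv_symm, ← mfderiv_symm_eq he he' hy, ← mfderiv_symm_eq he he' hy,
        e'.left_inv h2]
    change g.inner (e.symm y) (mfderiv (𝓡 n) (𝓡 n) e.symm y _)
      (mfderiv (𝓡 n) (𝓡 n) e.symm y _) = _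
    rw [h3]
    have h4 : ∀ a i, (fderiv ℝ (e' ∘ e.symm) y (EuclideanSpace.single i 1)) a
        = Coord.jacobian (e' ∘ e.symm) y a i := by
      intro a i
      rw [fderiv_apply_eq_mulVec he he' hy]
      simp [Matrix.mulVec, dotProduct]
    simp only [h4, Matrix.mul_apply, Matrix.transpose_apply, Finset.sum_mul]
    rw [Finset.sum_comm]
    exact Finset.sum_congr rfl fun a _ => Finset.sum_congr rfl fun b _ => by
      rw [Function.comp_apply]; ring

end Metric

end LorentzMetric

/-! ### The volume measure in charts. -/

namespace LorentzMetric

variable {n : ℕ} {M : Type*} [TopologicalSpace M]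

section ChartMeasurability

variable [MeasurableSpace M] [BorelSpace M]

/-- The inverse chart is controlled only on its target, so measurability holds only almost
everywhere for measures concentrated there. -/
theorem aemeasurable_symm (e : OpenPartialHomeomorph M (CoordSpace n))
    (ρ : CoordSpace n → ENNReal) :
    AEMeasurable e.symm (((volume : Measure (CoordSpace n)).restrict e.target).withDensity ρ) :=
  (e.continuousOn_symm.aemeasurable e.open_target.measurableSet).mono_ac
    (withDensity_absolutelyContinuous _ _)

theorem measurableSet_symm_preimage (e : OpenPartialHomeomorph M (CoordSpace n)) {A : Set M}
    (hA : MeasurableSet A) : MeasurableSet (e.symm ⁻¹' A ∩ e.target) := by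
  have h1 : Measurable (e.target.domRestrict e.symm) :=
    (continuousOn_iff_continuous_domRestrict.1 e.continuousOn_symm).measurable
  have h2 := e.open_target.measurableSet.subtype_image (h1 hA)
  convert h2 using 1
  ext y
  simp only [mem_inter_iff, mem_preimage, mem_image, Subtype.exists,
    exists_and_right, exists_eq_right]
  tauto

end ChartMeasurability

variable [ChartedSpace (CoordSpace n) M] [IsManifold (𝓡 n) ∞ M]

section Volume

variable (g : LorentzMetric n M)
  {e e' : OpenPartialHomeomorph M (CoordSpace n)}

theorem continuousOn_sqrt_det (he : e ∈ atlas (CoordSpace n) M) :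
    ContinuousOn (fun y => √|(g.components e y).det|) e.target :=
  (g.isMetricOn_components he).contDiffOn_sqrt_det.continuousOn

theorem aemeasurable_density (he : e ∈ atlas (CoordSpace n) M) :
    AEMeasurable (fun y => ENNReal.ofReal √|(g.components e y).det|)
      ((volume : Measure (CoordSpace n)).restrict e.target) :=
  ((g.continuousOn_sqrt_det he).aemeasurable e.open_target.measurableSet).ennreal_ofReal

theorem det_fderiv_transition (he : e ∈ atlas (CoordSpace n) M)
    (he' : e' ∈ atlas (CoordSpace n) M) {y : CoordSpace n} (hy : y ∈ overlap e e') :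
    (fderiv ℝ (e' ∘ e.symm) y).det = (Coord.jacobian (e' ∘ e.symm) y).det := by
  rw [ContinuousLinearMap.det,
    ← LinearMap.det_toMatrix (EuclideanSpace.basisFun (Fin n) ℝ).toBasis]
  congr 1
  ext a i
  rw [LinearMap.toMatrix_apply]
  have := fderiv_apply_eq_mulVec he he' hy (EuclideanSpace.single i 1) a
  simp [Matrix.mulVec, dotProduct] at this
  simpa using this

/-- From `G = Jᵀ G' J`, the density picks up `|det J|`, the factor in the change of variables
formula. -/
theorem sqrt_det_transition (he : e ∈ atlas (CoordSpace n) M)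
    (he' : e' ∈ atlas (CoordSpace n) M) {y : CoordSpace n} (hy : y ∈ overlap e e') :
    √|(g.components e y).det| = |(fderiv ℝ (e' ∘ e.symm) y).det|
      * √|(g.components e' ((e' ∘ e.symm) y)).det| := by
  rw [det_fderiv_transition he he' hy, (g.isIsometryOn_transition he he').pullback y hy,
    Matrix.det_mul, Matrix.det_mul, Matrix.det_transpose, mul_right_comm, abs_mul,
    Real.sqrt_mul (abs_nonneg _), abs_mul_self, Real.sqrt_mul_self_eq_abs]

variable [MeasurableSpace M] [BorelSpace M]

theorem chartVolume_apply (e : OpenPartialHomeomorph M (CoordSpace n)) {A : Set M}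
    (hA : MeasurableSet A) :
    g.chartVolume e A = ∫⁻ y in e.symm ⁻¹' A ∩ e.target,
      ENNReal.ofReal √|(g.components e y).det| := by
  rw [chartVolume, Measure.map_apply_of_aemeasurable (aemeasurable_symm e _) hA, withDensity_apply',
    Measure.restrict_restrict' e.open_target.measurableSet]

theorem chartVolume_compl_source (e : OpenPartialHomeomorph M (CoordSpace n)) :
    g.chartVolume e e.sourceᶜ = 0 := by
  rw [g.chartVolume_apply e e.open_source.measurableSet.compl]
  have : e.symm ⁻¹' e.sourceᶜ ∩ e.target = ∅ := by
    ext y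
    simp only [mem_inter_iff, mem_preimage, mem_compl_iff, mem_empty_iff_false, iff_false, not_and]
    exact fun h1 h2 => h1 (e.map_target h2)
  rw [this, Measure.restrict_empty, lintegral_zero_measure]

theorem chartVolume_eq_of_subset (he : e ∈ atlas (CoordSpace n) M)
    (he' : e' ∈ atlas (CoordSpace n) M) {A : Set M} (hA : MeasurableSet A)
    (h1 : A ⊆ e.source) (h2 : A ⊆ e'.source) : g.chartVolume e' A = g.chartVolume e A := by
  rw [g.chartVolume_apply e hA, g.chartVolume_apply e' hA]
  have hsub : e.symm ⁻¹' A ∩ e.target ⊆ overlap e e' := fun y hy => mem_overlap.2 ⟨hy.2, h2 hy.1⟩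
  have himg : e'.symm ⁻¹' A ∩ e'.target = (e' ∘ e.symm) '' (e.symm ⁻¹' A ∩ e.target) := by
    ext z
    constructor
    · rintro ⟨hz1, hz2⟩
      refine ⟨e (e'.symm z), ⟨?_, e.map_source (h1 hz1)⟩, ?_⟩
      · rw [mem_preimage, e.left_inv (h1 hz1)]
        exact hz1
      · rw [Function.comp_apply, e.left_inv (h1 hz1), e'.right_inv hz2]
    · rintro ⟨y, ⟨hy1, hy2⟩, rfl⟩
      refine ⟨?_, e'.map_source (h2 hy1)⟩
      rw [mem_preimage, Function.comp_apply, e'.left_inv (h2 hy1)]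
      exact hy1
  have hinj : InjOn (e' ∘ e.symm) (e.symm ⁻¹' A ∩ e.target) :=
    (e.symm.trans e').injOn.mono hsub
  rw [himg, lintegral_image_eq_lintegral_abs_det_fderiv_mul volume
    (measurableSet_symm_preimage e hA) (fun y hy =>
      (((contDiffOn_transition he he').contDiffAt
        (isOpen_overlap.mem_nhds (hsub hy))).differentiableAt (by simp)).hasFDerivAt.hasFDerivWithinAt)
    hinj]
  refine setLIntegral_congr_fun (measurableSet_symm_preimage e hA) fun y hy => ?_
  rw [g.sqrt_det_transition he he' (hsub hy), ENNReal.ofReal_mul (abs_nonneg _)]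

/-- The volume measure restricts to `√|det g| dx¹ ⋯ dxⁿ` on the domain of each chart. -/
theorem volumeMeasure_restrict_source (he : e ∈ atlas (CoordSpace n) M) :
    g.volumeMeasure.restrict e.source = g.chartVolume e := by
  have hm := e.open_source.measurableSet
  have hle : g.chartVolume e ≤ g.volumeMeasure :=
    le_iSup₂ (f := fun e (_ : e ∈ atlas (CoordSpace n) M) => g.chartVolume e) e he
  have hrestr : g.chartVolume e = (g.chartVolume e).restrict e.source := by
    rw [Measure.restrict_eq_self_of_ae_mem]
    exact g.chartVolume_compl_source e
  -- The supremum is bounded by one measure dominating every chart volume. Inside `e.source`, the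
  -- part in another chart's domain has the same volume in both charts, and the part outside that
  -- domain is null for the other chart. Outside `e.source`, the volume measure itself is used.
  have hge : g.volumeMeasure ≤ g.chartVolume e + g.volumeMeasure.restrict e.sourceᶜ := by
    refine iSup₂_le fun e' he' => Measure.le_iff.2 fun A hA => ?_
    have hle' : g.chartVolume e' ≤ g.volumeMeasure :=
      le_iSup₂ (f := fun e (_ : e ∈ atlas (CoordSpace n) M) => g.chartVolume e) e' he'
    rw [← measure_inter_add_sdiff A hm, Measure.add_apply, Measure.restrict_apply hA]
    refine add_le_add ?_ (hle' _)
    have hm' := e'.open_source.measurableSet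
    rw [← measure_inter_add_sdiff (A ∩ e.source) hm',
      measure_mono_null (s := (A ∩ e.source) \ e'.source) (fun x hx => hx.2)
        (g.chartVolume_compl_source e'), add_zero,
      g.chartVolume_eq_of_subset he he' ((hA.inter hm).inter hm') (fun x hx => hx.1.2)
        fun x hx => hx.2]
    exact measure_mono fun x hx => hx.1.1
  refine le_antisymm ?_ ?_
  · refine (Measure.restrict_mono le_rfl hge).trans ?_
    rw [Measure.restrict_add, Measure.restrict_restrict hm, inter_compl_self,
      Measure.restrict_empty, add_zero, ← hrestr]
  · rw [hrestr]
    exact Measure.restrict_mono le_rfl hle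

theorem integral_eq_setIntegral_chart (he : e ∈ atlas (CoordSpace n) M) {h : M → ℝ}
    (hc : Continuous h) (h0 : ∀ x ∉ e.source, h x = 0) :
    ∫ x, h x ∂g.volumeMeasure
      = ∫ y in e.target, √|(g.components e y).det| * h (e.symm y) := by
  rw [← setIntegral_eq_integral_of_forall_compl_eq_zero h0, g.volumeMeasure_restrict_source he,
    chartVolume, integral_map (aemeasurable_symm e _) hc.aestronglyMeasurable,
    integral_withDensity_eq_integral_toReal_smul₀ (g.aemeasurable_density he)
      (Filter.Eventually.of_forall fun _ => ENNReal.ofReal_lt_top)]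
  simp only [ENNReal.toReal_ofReal (Real.sqrt_nonneg _), smul_eq_mul]

/-- The density is continuous, hence integrable on a compact coordinate neighbourhood. All
integrability below follows from this for continuous functions of compact support. -/
theorem isLocallyFiniteMeasure_volumeMeasure [T2Space M] :
    IsLocallyFiniteMeasure g.volumeMeasure := by
  refine ⟨fun x => ?_⟩
  set e := chartAt (CoordSpace n) x with he_def
  have he : e ∈ atlas (CoordSpace n) M := chart_mem_atlas _ x
  have hx : x ∈ e.source := mem_chart_source _ x
  obtain ⟨K, hK, hKx, hKsub⟩ := exists_compact_subset e.open_target (e.map_source hx)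
  have hcomp : IsCompact (e.symm '' K) := hK.image_of_continuousOn (e.continuousOn_symm.mono hKsub)
  have hsub : e.symm '' K ⊆ e.source := by
    rintro _ ⟨y, hy, rfl⟩
    exact e.map_target (hKsub hy)
  refine ⟨e.symm '' K, ?_, ?_⟩
  · filter_upwards [e.continuousAt hx (isOpen_interior.mem_nhds hKx),
      e.open_source.mem_nhds hx] with z hz hz'
    exact ⟨e z, interior_subset hz, e.left_inv hz'⟩
  · have h1 : g.volumeMeasure (e.symm '' K) = g.chartVolume e (e.symm '' K) := by
      rw [← g.volumeMeasure_restrict_source he, Measure.restrict_eq_self _ hsub]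
    rw [h1, g.chartVolume_apply e hcomp.isClosed.measurableSet]
    have h2 : e.symm ⁻¹' (e.symm '' K) ∩ e.target ⊆ K := by
      rintro y ⟨⟨z, hz, hzy⟩, hy⟩
      rwa [← e.symm.injOn (hKsub hz) hy hzy]
    have h3 : IntegrableOn (fun y => √|(g.components e y).det|) K volume :=
      ((g.continuousOn_sqrt_det he).mono hKsub).integrableOn_compact hK
    exact (lintegral_mono_set h2).trans_lt h3.lintegral_lt_top

end Volume

end LorentzMetric

/-! ### The divergence theorem on the manifold. -/

namespace LorentzMetric

variable {n : ℕ} {M : Type*} [TopologicalSpace M]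

theorem map_mem_overlap {e e' : OpenPartialHomeomorph M (CoordSpace n)} {x : M}
    (hx : x ∈ e.source) (hx' : x ∈ e'.source) : e x ∈ overlap e e' :=
  mem_overlap.2 ⟨e.map_source hx, by rwa [e.left_inv hx]⟩

variable [ChartedSpace (CoordSpace n) M]

/-- `Y e` is, for the charts `e` of the atlas, the list of components of a `C¹` vector field. -/
structure IsVectorField
    (Y : OpenPartialHomeomorph M (CoordSpace n) → CoordSpace n → Fin n → ℝ) : Prop where
  contDiffOn : ∀ e ∈ atlas (CoordSpace n) M, ∀ k, ContDiffOn ℝ 1 (fun y => Y e y k) e.target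
  transition : ∀ e ∈ atlas (CoordSpace n) M, ∀ e' ∈ atlas (CoordSpace n) M, ∀ y ∈ overlap e e',
    Y e' ((e' ∘ e.symm) y) = Coord.jacobian (e' ∘ e.symm) y *ᵥ Y e y

/-- The preferred chart may jump from point to point, so a scalar defined through it is seen to be
continuous only after one formula in a fixed chart is known to hold on the whole domain. -/
theorem continuous_of_charts {h : M → ℝ} (hh : ∀ e ∈ atlas (CoordSpace n) M,
    ∃ F : CoordSpace n → ℝ, ContinuousOn F e.target ∧ ∀ x ∈ e.source, h x = F (e x)) :
    Continuous h := by
  refine continuous_iff_continuousAt.2 fun x => ?_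
  obtain ⟨F, hF, hFx⟩ := hh _ (chart_mem_atlas (CoordSpace n) x)
  have hx := mem_chart_source (CoordSpace n) x
  set e := chartAt (CoordSpace n) x
  have h1 : ContinuousAt (F ∘ e) x :=
    ContinuousAt.comp (hF.continuousAt (e.open_target.mem_nhds (e.map_source hx)))
      (e.continuousAt hx)
  refine h1.congr ?_
  filter_upwards [e.open_source.mem_nhds hx] with z hz
  exact (hFx z hz).symm

namespace IsVectorField

variable {Y : OpenPartialHomeomorph M (CoordSpace n) → CoordSpace n → Fin n → ℝ}
  {e : OpenPartialHomeomorph M (CoordSpace n)}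

theorem differentiableOn (hY : IsVectorField Y) (he : e ∈ atlas (CoordSpace n) M) (k : Fin n) :
    DifferentiableOn ℝ (fun y => Y e y k) e.target :=
  (hY.contDiffOn e he k).differentiableOn (by norm_num)

theorem smul [IsManifold (𝓡 n) ∞ M] (hY : IsVectorField Y) {h : M → ℝ}
    (hh : ContMDiff (𝓡 n) 𝓘(ℝ, ℝ) 1 h) :
    IsVectorField (fun e y k => h (e.symm y) * Y e y k) where
  contDiffOn e he k := (contMDiffOn_iff_contDiffOn.1 (hh.comp_contMDiffOn
    ((contMDiffOn_symm he).of_le (WithTop.coe_le_coe.2 le_top)))).mul (hY.contDiffOn e he k)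
  transition e he e' he' y hy := by
    have h1 : e'.symm ((e' ∘ e.symm) y) = e.symm y := e'.left_inv (mem_overlap.1 hy).2
    change (fun k => _) = Coord.jacobian (e' ∘ e.symm) y *ᵥ (h (e.symm y) • Y e y)
    rw [Matrix.mulVec_smul, ← hY.transition e he e' he' y hy, h1]
    rfl

end IsVectorField

variable [IsManifold (𝓡 n) ∞ M] (g : LorentzMetric n M)
  {Y : OpenPartialHomeomorph M (CoordSpace n) → CoordSpace n → Fin n → ℝ}
  {e : OpenPartialHomeomorph M (CoordSpace n)}

/-- The divergence at `x` of the vector field with components `Y e` in the chart `e`. -/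
def divergenceOf (Y : OpenPartialHomeomorph M (CoordSpace n) → CoordSpace n → Fin n → ℝ)
    (x : M) : ℝ :=
  ∑ i, Coord.covDeriv (g.components (chartAt (CoordSpace n) x)) (Y (chartAt (CoordSpace n) x))
    i i (chartAt (CoordSpace n) x x)

theorem divergenceOf_eq (hY : IsVectorField Y) (he : e ∈ atlas (CoordSpace n) M) {x : M}
    (hx : x ∈ e.source) :
    g.divergenceOf Y x = ∑ i, Coord.covDeriv (g.components e) (Y e) i i (e x) := by
  have he' := chart_mem_atlas (CoordSpace n) x
  have h := (g.isIsometryOn_transition he he').sum_covDeriv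
    (fun k => (hY.differentiableOn he k).mono fun _ hy => (mem_overlap.1 hy).1)
    (hY.differentiableOn he') (hY.transition e he _ he')
    (map_mem_overlap hx (mem_chart_source (CoordSpace n) x))
  rw [Function.comp_apply, e.left_inv hx] at h
  exact h

theorem continuousOn_sum_covDeriv (hY : IsVectorField Y) (he : e ∈ atlas (CoordSpace n) M) :
    ContinuousOn (fun y => ∑ i, Coord.covDeriv (g.components e) (Y e) i i y) e.target := by
  refine continuousOn_finsetSum _ fun i _ => ContinuousOn.add ?_ ?_
  · exact (Coord.contDiffOn_partialDeriv (k := 0) e.open_target (hY.contDiffOn e he i)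
      (by norm_num) i).continuousOn
  · exact continuousOn_finsetSum _ fun l _ =>
      ((g.isMetricOn_components he).contDiffOn_christoffel i i l).continuousOn.mul
        (hY.contDiffOn e he l).continuousOn

theorem continuous_divergenceOf (hY : IsVectorField Y) : Continuous (g.divergenceOf Y) :=
  continuous_of_charts fun _ he =>
    ⟨_, g.continuousOn_sum_covDeriv hY he, fun _ hx => g.divergenceOf_eq hY he hx⟩

/-- As `K` is closed, the components vanish on a neighbourhood of the point, and so do their
derivatives. -/
theorem divergenceOf_eq_zero {K : Set M} (hK : IsClosed K)
    (h0 : ∀ e ∈ atlas (CoordSpace n) M, ∀ y ∈ e.target, e.symm y ∉ K → Y e y = 0) {x : M}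
    (hx : x ∉ K) : g.divergenceOf Y x = 0 := by
  have hxs := mem_chart_source (CoordSpace n) x
  have he := chart_mem_atlas (CoordSpace n) x
  unfold divergenceOf
  set e := chartAt (CoordSpace n) x
  have ho : IsOpen (e.target ∩ e.symm ⁻¹' Kᶜ) := e.isOpen_inter_preimage_symm hK.isOpen_compl
  refine Finset.sum_eq_zero fun i _ => ?_
  rw [Coord.covDeriv_congr (Z := fun _ _ => 0) _ ho (fun z hz => h0 e he z hz.1 hz.2)
    ⟨e.map_source hxs, by rwa [mem_preimage, e.left_inv hxs]⟩]
  simp [Coord.covDeriv, Coord.partialDeriv_const]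

theorem integral_partialDeriv_eq_zero {F : CoordSpace n → ℝ} (hF : ContDiff ℝ 1 F)
    (hc : HasCompactSupport F) (i : Fin n) : ∫ y, Coord.partialDeriv i F y = 0 := by
  have h1 : Continuous (Coord.partialDeriv i F) :=
    (hF.continuous_fderiv (by norm_num)).clm_apply continuous_const
  have h2 : HasCompactSupport (Coord.partialDeriv i F) :=
    hc.fderiv_apply (𝕜 := ℝ) (v := EuclideanSpace.single i 1)
  have h := integral_mul_fderiv_eq_neg_fderiv_mul_of_integrable (μ := volume) (𝕜 := ℝ)
    (f := fun _ : CoordSpace n => (1 : ℝ)) (g := F) (v := EuclideanSpace.single i (1 : ℝ))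
    (by simp) (by simp only [one_mul]; exact h1.integrable_of_hasCompactSupport h2)
    (by simpa using hF.continuous.integrable_of_hasCompactSupport hc)
    (fun _ _ => differentiableAt_const _) (fun x _ => (hF.differentiable (by norm_num)) x)
  simpa [Coord.partialDeriv] using h

variable [MeasurableSpace M] [BorelSpace M]

/-- In a single chart `√|det g| div Y = ∑ ∂_i(√|det g| Yⁱ)`. Extended by zero, the functions under
the derivatives are `C¹` with compact support on `ℝⁿ`, so each derivative integrates to zero. -/
theorem integral_divergenceOf_of_subset_source [T2Space M] (hY : IsVectorField Y)
    (he : e ∈ atlas (CoordSpace n) M) {K : Set M} (hK : IsCompact K) (hKe : K ⊆ e.source)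
    (h0 : ∀ e ∈ atlas (CoordSpace n) M, ∀ y ∈ e.target, e.symm y ∉ K → Y e y = 0) :
    ∫ x, g.divergenceOf Y x ∂g.volumeMeasure = 0 := by
  have hG := g.isMetricOn_components he
  rw [g.integral_eq_setIntegral_chart he (g.continuous_divergenceOf hY)
    fun x hx => g.divergenceOf_eq_zero hK.isClosed h0 fun h => hx (hKe h)]
  set F : Fin n → CoordSpace n → ℝ := fun i =>
    e.target.indicator (fun y => √|(g.components e y).det| * Y e y i) with hF
  have hKc : IsCompact (e '' K) := hK.image_of_continuousOn (e.continuousOn.mono hKe)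
  have hKt : e '' K ⊆ e.target := by
    rintro _ ⟨x, hx, rfl⟩
    exact e.map_source (hKe hx)
  have hF0 : ∀ i, ∀ y ∉ e '' K, F i y = 0 := by
    intro i y hy
    by_cases hyt : y ∈ e.target
    · have : e.symm y ∉ K := fun h => hy ⟨_, h, e.right_inv hyt⟩
      simp [hF, h0 e he y hyt this]
    · simp [hF, hyt]
  have hFt : ∀ i, EqOn (F i) (fun y => √|(g.components e y).det| * Y e y i) e.target :=
    fun i y hy => indicator_of_mem hy _
  have hFc : ∀ i, HasCompactSupport (F i) := fun i => HasCompactSupport.intro hKc (hF0 i)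
  have hFd : ∀ i, ContDiff ℝ 1 (F i) := by
    intro i
    refine contDiff_iff_contDiffAt.2 fun y => ?_
    by_cases hy : y ∈ e.target
    · have h1 : ContDiffOn ℝ 1 (fun y => √|(g.components e y).det| * Y e y i) e.target :=
        (hG.contDiffOn_sqrt_det.of_le (WithTop.coe_le_coe.2 le_top)).mul (hY.contDiffOn e he i)
      exact (h1.contDiffAt (e.open_target.mem_nhds hy)).congr_of_eventuallyEq
        ((hFt i).eventuallyEq_of_mem (e.open_target.mem_nhds hy))
    -- Outside the target, in particular on its boundary, the extension vanishes near `y`, because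
    -- the image of `K` is closed and contained in the target.
    · have hy' : y ∈ (e '' K)ᶜ := fun h => hy (hKt h)
      exact (contDiffAt_const (c := (0 : ℝ))).congr_of_eventuallyEq
        (Filter.mem_of_superset (hKc.isClosed.isOpen_compl.mem_nhds hy') (hF0 i))
  have h1 : ∀ y ∈ e.target, √|(g.components e y).det| * g.divergenceOf Y (e.symm y)
      = ∑ i, Coord.partialDeriv i (F i) y := by
    intro y hy
    rw [g.divergenceOf_eq hY he (e.map_target hy), e.right_inv hy,
      ← hG.sum_partialDeriv_sqrt_det_mul hy
        fun k => (hY.differentiableOn he k).differentiableAt (e.open_target.mem_nhds hy)]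
    exact Finset.sum_congr rfl fun i _ =>
      (Coord.partialDeriv_congr e.open_target (hFt i) hy i).symm
  have hpc : ∀ i, Continuous (Coord.partialDeriv i (F i)) := fun i =>
    ((hFd i).continuous_fderiv (by norm_num)).clm_apply continuous_const
  rw [setIntegral_congr_fun e.open_target.measurableSet h1,
    setIntegral_eq_integral_of_forall_compl_eq_zero, integral_finsetSum]
  · exact Finset.sum_eq_zero fun i _ => integral_partialDeriv_eq_zero (hFd i) (hFc i) i
  · exact fun i _ => (hpc i).integrable_of_hasCompactSupport
      ((hFc i).fderiv_apply (𝕜 := ℝ) (v := EuclideanSpace.single i 1))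
  · intro y hy
    refine Finset.sum_eq_zero fun i _ => ?_
    rw [Coord.partialDeriv_congr (H := fun _ => 0) hKc.isClosed.isOpen_compl (hF0 i)
      (fun h => hy (hKt h)), Coord.partialDeriv_const]

/-- The divergence theorem for a compactly supported `C¹` vector field. -/
theorem integral_divergenceOf [T2Space M] [SecondCountableTopology M] (hY : IsVectorField Y)
    {K : Set M} (hK : IsCompact K)
    (h0 : ∀ e ∈ atlas (CoordSpace n) M, ∀ y ∈ e.target, e.symm y ∉ K → Y e y = 0) :
    ∫ x, g.divergenceOf Y x ∂g.volumeMeasure = 0 := by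
  have : LocallyCompactSpace M := ChartedSpace.locallyCompactSpace (CoordSpace n) M
  have : SigmaCompactSpace M := sigmaCompactSpace_of_locallyCompact_secondCountable
  have := g.isLocallyFiniteMeasure_volumeMeasure
  obtain ⟨χ, hχ⟩ := SmoothPartitionOfUnity.exists_isSubordinate_chartAt_source (𝓡 n) M
  -- Only finitely many members of the partition of unity meet `K`, and these sum to one there. As
  -- `Y` vanishes off `K`, it is the finite sum of the fields `χ i • Y`, each supported in one
  -- chart.
  have hfin : {i | (Function.support (χ i) ∩ K).Nonempty}.Finite :=
    χ.locallyFinite.finite_nonempty_inter_compact hK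
  set Z : M → OpenPartialHomeomorph M (CoordSpace n) → CoordSpace n → Fin n → ℝ :=
    fun i e y k => χ i (e.symm y) * Y e y k with hZdef
  have hZ : ∀ i, IsVectorField (Z i) := fun i =>
    hY.smul ((χ i).contMDiff.of_le (WithTop.coe_le_coe.2 le_top))
  have hsum : ∀ x ∈ K, ∑ i ∈ hfin.toFinset, χ i x = 1 := by
    intro x hx
    rw [← χ.sum_eq_one (mem_univ x)]
    refine (finsum_eq_sum_of_support_subset _ fun i hi => ?_).symm
    rw [hfin.coe_toFinset]
    exact ⟨x, hi, hx⟩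
  have hYZ : ∀ e ∈ atlas (CoordSpace n) M, ∀ y ∈ e.target,
      Y e y = fun k => ∑ i ∈ hfin.toFinset, Z i e y k := by
    intro e he y hy
    funext k
    simp only [hZdef, ← Finset.sum_mul]
    by_cases hyK : e.symm y ∈ K
    · rw [hsum _ hyK, one_mul]
    · rw [h0 e he y hy hyK, Pi.zero_apply, mul_zero]
  have hdiv : ∀ x, g.divergenceOf Y x = ∑ i ∈ hfin.toFinset, g.divergenceOf (Z i) x := by
    intro x
    have hx := mem_chart_source (CoordSpace n) x
    have he := chart_mem_atlas (CoordSpace n) x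
    unfold divergenceOf
    set e := chartAt (CoordSpace n) x
    rw [Finset.sum_comm]
    refine Finset.sum_congr rfl fun j _ => ?_
    rw [Coord.covDeriv_congr _ e.open_target (hYZ e he) (e.map_source hx), Coord.covDeriv_sum]
    exact fun i _ k => ((hZ i).differentiableOn he k).differentiableAt
      (e.open_target.mem_nhds (e.map_source hx))
  have hZ0 : ∀ i, ∀ e ∈ atlas (CoordSpace n) M, ∀ y ∈ e.target,
      e.symm y ∉ K ∩ tsupport (χ i) → Z i e y = 0 := by
    intro i e he y hy hyK
    funext k
    by_cases h1 : e.symm y ∈ K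
    · simp [hZdef, image_eq_zero_of_notMem_tsupport fun h => hyK ⟨h1, h⟩]
    · simp [hZdef, h0 e he y hy h1]
  have hKi : ∀ i, IsCompact (K ∩ tsupport (χ i)) := fun i => hK.inter_right (isClosed_tsupport _)
  simp only [hdiv]
  rw [integral_finsetSum]
  · exact Finset.sum_eq_zero fun i _ => g.integral_divergenceOf_of_subset_source (hZ i)
      (chart_mem_atlas (CoordSpace n) i) (hKi i) (inter_subset_right.trans (hχ i)) (hZ0 i)
  · exact fun i _ => (g.continuous_divergenceOf (hZ i)).integrable_of_hasCompactSupport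
      (HasCompactSupport.intro (hKi i) fun x hx =>
        g.divergenceOf_eq_zero (hKi i).isClosed (hZ0 i) hx)

end LorentzMetric

/-! ### The global fields and the pointwise formula for the effective energy density. -/

namespace Coord.IsIsometryOn

variable {n : ℕ} {τ : CoordSpace n → CoordSpace n}
  {G G' : CoordSpace n → Matrix (Fin n) (Fin n) ℝ} {s s' : Set (CoordSpace n)}
  {y : CoordSpace n}

/-- The directional derivative of a function is independent of coordinates. -/
theorem sum_mul_partialDeriv (h : IsIsometryOn τ G G' s s') (hy : y ∈ s)
    {F F' : CoordSpace n → ℝ} (hF' : DifferentiableOn ℝ F' s') (hFF' : ∀ z ∈ s, F' (τ z) = F z)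
    {w w' : Fin n → ℝ} (hw : w' = jacobian τ y *ᵥ w) :
    ∑ j, w' j * partialDeriv j F' (τ y) = ∑ j, w j * partialDeriv j F y := by
  have e : ∀ i, partialDeriv i F y = ∑ c, jacobian τ y c i * partialDeriv c F' (τ y) := by
    intro i
    rw [← partialDeriv_congr h.source.isOpen hFF' hy i,
      h.partialDeriv_comp hy (hF'.differentiableAt (h.target.mem_nhds (h.mapsTo hy)))]
  simp only [e, hw, Matrix.mulVec, dotProduct, Finset.sum_mul, Finset.mul_sum]
  rw [Finset.sum_comm]
  exact Finset.sum_congr rfl fun i _ => Finset.sum_congr rfl fun j _ => by ring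

end Coord.IsIsometryOn

namespace LorentzMetric

variable {n : ℕ} {M : Type*} [TopologicalSpace M]

theorem comp_symm_transition {e e' : OpenPartialHomeomorph M (CoordSpace n)} {y : CoordSpace n}
    (hy : y ∈ overlap e e') (φ : M → ℝ) :
    (φ ∘ e'.symm) ((e' ∘ e.symm) y) = (φ ∘ e.symm) y :=
  congrArg φ (e'.left_inv (mem_overlap.1 hy).2)

variable [ChartedSpace (CoordSpace n) M]

theorem vectorComponents_smul {f : M → ℝ} {U V : ∀ x : M, TangentSpace (𝓡 n) x}
    (hV : ∀ x, V x = f x • U x)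
    (e : OpenPartialHomeomorph M (CoordSpace n)) (y : CoordSpace n) (i : Fin n) :
    vectorComponents e V y i = f (e.symm y) * vectorComponents e U y i := by
  unfold vectorComponents
  rw [hV]
  exact congrArg (fun v : CoordSpace n => v i) (map_smul (mfderiv (𝓡 n) (𝓡 n) e (e.symm y)) _ _)

/-- The directional derivative `V φ`. -/
def directionalDeriv (V : ∀ x : M, TangentSpace (𝓡 n) x) (φ : M → ℝ) (x : M) : ℝ :=
  ∑ j, vectorComponents (chartAt (CoordSpace n) x) V (chartAt (CoordSpace n) x x) j *
    Coord.partialDeriv j (φ ∘ (chartAt (CoordSpace n) x).symm) (chartAt (CoordSpace n) x x)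

theorem directionalDeriv_smul {f : M → ℝ} {U V : ∀ x : M, TangentSpace (𝓡 n) x}
    (hV : ∀ x, V x = f x • U x) (φ : M → ℝ) (x : M) :
    directionalDeriv V φ x = f x * directionalDeriv U φ x := by
  unfold directionalDeriv
  rw [Finset.mul_sum]
  refine Finset.sum_congr rfl fun j _ => ?_
  rw [vectorComponents_smul hV, OpenPartialHomeomorph.left_inv _ (mem_chart_source _ x), mul_assoc]

theorem IsVectorField.add
    {Y Z : OpenPartialHomeomorph M (CoordSpace n) → CoordSpace n → Fin n → ℝ}
    (hY : IsVectorField Y) (hZ : IsVectorField Z) :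
    IsVectorField (fun e y k => Y e y k + Z e y k) where
  contDiffOn e he k := (hY.contDiffOn e he k).add (hZ.contDiffOn e he k)
  transition e he e' he' y hy := by
    change Y e' ((e' ∘ e.symm) y) + Z e' ((e' ∘ e.symm) y)
      = Coord.jacobian (e' ∘ e.symm) y *ᵥ (Y e y + Z e y)
    rw [Matrix.mulVec_add, hY.transition e he e' he' y hy, hZ.transition e he e' he' y hy]

variable [IsManifold (𝓡 n) ∞ M] (g : LorentzMetric n M)
  {e e' : OpenPartialHomeomorph M (CoordSpace n)} {φ f : M → ℝ}
  {U V W : ∀ x : M, TangentSpace (𝓡 n) x}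

theorem contDiffOn_comp_symm {k : ℕ∞} (hφ : ContMDiff (𝓡 n) 𝓘(ℝ, ℝ) k φ)
    (he : e ∈ atlas (CoordSpace n) M) : ContDiffOn ℝ k (φ ∘ e.symm) e.target :=
  contMDiffOn_iff_contDiffOn.1 (hφ.comp_contMDiffOn
    ((contMDiffOn_symm he).of_le (WithTop.coe_le_coe.2 le_top)))

/-- A vector field whose components are twice continuously differentiable in each chart. -/
def IsC2VectorField (V : ∀ x : M, TangentSpace (𝓡 n) x) : Prop :=
  ∀ e ∈ atlas (CoordSpace n) M, ∀ i,
    ContDiffOn ℝ 2 (fun y => vectorComponents e V y i) e.target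

theorem isC2VectorField_smul (hV : ∀ x, V x = f x • U x)
    (hU : ContMDiff (𝓡 n) (𝓡 n).tangent 2 (fun x => (⟨x, U x⟩ : TangentBundle (𝓡 n) M)))
    (hf : ContMDiff (𝓡 n) 𝓘(ℝ, ℝ) 2 f) : IsC2VectorField V := by
  intro e he i
  simp only [vectorComponents_smul hV]
  exact (contDiffOn_comp_symm (k := 2) hf he).mul (contDiffOn_vectorComponents (k := 2) he hU i)

theorem IsC2VectorField.isVectorField (hV : IsC2VectorField V) :
    IsVectorField (fun e => vectorComponents e V) where
  contDiffOn e he k := (hV e he k).of_le (by norm_num)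
  transition _ he _ he' _ hy := vectorComponents_transition he he' V hy

theorem isVectorField_gradient (hφ : ContMDiff (𝓡 n) 𝓘(ℝ, ℝ) 2 φ) :
    IsVectorField (fun e => Coord.gradient (g.components e) (φ ∘ e.symm)) where
  contDiffOn e he k := (g.isMetricOn_components he).contDiffOn_gradient
    (contDiffOn_comp_symm (k := 2) hφ he) k
  transition e he e' he' y hy := (g.isIsometryOn_transition he he').gradient_law
    ((contDiffOn_comp_symm (k := 2) hφ he').differentiableOn (by norm_num))
    (fun _ hz => comp_symm_transition hz φ) hy

theorem divergenceOf_gradient (hφ : ContMDiff (𝓡 n) 𝓘(ℝ, ℝ) 2 φ) (x : M) :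
    g.divergenceOf (fun e => Coord.gradient (g.components e) (φ ∘ e.symm)) x
      = g.dAlembertian φ x :=
  (g.isMetricOn_components (chart_mem_atlas _ x)).sum_covDeriv_gradient
    (OpenPartialHomeomorph.map_source _ (mem_chart_source _ x))
    (contDiffOn_comp_symm (k := 2) hφ (chart_mem_atlas _ x))

theorem continuous_dAlembertian (hφ : ContMDiff (𝓡 n) 𝓘(ℝ, ℝ) 2 φ) :
    Continuous (g.dAlembertian φ) :=
  (g.continuous_divergenceOf (g.isVectorField_gradient hφ)).congr (g.divergenceOf_gradient hφ)

theorem continuous_divergence (hV : IsC2VectorField V) : Continuous (g.divergence V) :=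
  g.continuous_divergenceOf hV.isVectorField

theorem continuous_covDerivTraceSq (hV : IsC2VectorField V) :
    Continuous (g.covDerivTraceSq V) := by
  refine continuous_of_charts fun e he => ⟨fun y => ∑ i, ∑ j,
    Coord.covDeriv (g.components e) (vectorComponents e V) i j y *
      Coord.covDeriv (g.components e) (vectorComponents e V) j i y, ?_, fun x hx => ?_⟩
  · have h := fun i j => ((g.isMetricOn_components he).contDiffOn_covDeriv (hV e he) i j).continuousOn
    exact continuousOn_finsetSum _ fun i _ => continuousOn_finsetSum _ fun j _ => (h i j).mul (h j i)
  · have he' := chart_mem_atlas (CoordSpace n) x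
    have h := (g.isIsometryOn_transition he he').sum_covDeriv_mul_covDeriv
      (fun k => (hV.isVectorField.differentiableOn he k).mono fun _ hy => (mem_overlap.1 hy).1)
      (hV.isVectorField.differentiableOn he') (hV.isVectorField.transition e he _ he')
      (map_mem_overlap hx (mem_chart_source (CoordSpace n) x))
    rw [Function.comp_apply, e.left_inv hx] at h
    exact h

include g in
theorem continuous_directionalDeriv (hV : IsC2VectorField V)
    (hφ : ContMDiff (𝓡 n) 𝓘(ℝ, ℝ) 2 φ) : Continuous (directionalDeriv V φ) := by
  refine continuous_of_charts fun e he => ⟨fun y => ∑ j, vectorComponents e V y j *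
    Coord.partialDeriv j (φ ∘ e.symm) y, ?_, fun x hx => ?_⟩
  · exact continuousOn_finsetSum _ fun j _ => (hV e he j).continuousOn.mul
      (Coord.contDiffOn_partialDeriv (k := 1) e.open_target
        (contDiffOn_comp_symm (k := 2) hφ he) (by norm_num) j).continuousOn
  · have he' := chart_mem_atlas (CoordSpace n) x
    have hy := map_mem_overlap hx (mem_chart_source (CoordSpace n) x)
    have h := (g.isIsometryOn_transition he he').sum_mul_partialDeriv hy
      ((contDiffOn_comp_symm (k := 2) hφ he').differentiableOn (by norm_num))
      (fun _ hz => comp_symm_transition hz φ) (vectorComponents_transition he he' V hy)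
    rw [Function.comp_apply, e.left_inv hx] at h
    exact h

/-- The components of `V (V ψ) - ψ (∇_V V - V div V)` with `ψ = φ²`. -/
def flux (V : ∀ x : M, TangentSpace (𝓡 n) x) (φ : M → ℝ)
    (e : OpenPartialHomeomorph M (CoordSpace n)) : CoordSpace n → Fin n → ℝ :=
  Coord.energyFlux (g.components e) (vectorComponents e V) ((fun z => φ z ^ 2) ∘ e.symm)

/-- The flux is a combination of the vectors `V` and `∇_V V` with the scalars `ψ`, `Vψ` and `div V`,
for each of which the transformation law is known. -/
theorem isVectorField_flux (hV : IsC2VectorField V) (hφ : ContMDiff (𝓡 n) 𝓘(ℝ, ℝ) 2 φ) :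
    IsVectorField (g.flux V φ) where
  contDiffOn e he k := (g.isMetricOn_components he).contDiffOn_energyFlux (hV e he)
    (contDiffOn_comp_symm (k := 2) (hφ.pow 2) he) k
  transition e he e' he' y hy := by
    have hI := g.isIsometryOn_transition he he'
    have hd := fun k => (hV.isVectorField.differentiableOn he k).mono
      fun _ (hy : _ ∈ overlap e e') => (mem_overlap.1 hy).1
    have hd' := hV.isVectorField.differentiableOn he'
    have ht := hV.isVectorField.transition e he _ he'
    have hψ := contDiffOn_comp_symm (k := 2) (hφ.pow 2) he'
    have h1 := hI.sum_mul_partialDeriv hy (hψ.differentiableOn (by norm_num))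
      (fun _ hz => comp_symm_transition hz _) (ht y hy)
    have h2 := hI.sum_mul_covDeriv hd hd' ht hy
    have h3 := hI.sum_covDeriv hd hd' ht hy
    have h4 := comp_symm_transition hy (fun z => φ z ^ 2)
    set J := Coord.jacobian (e' ∘ e.symm) y
    have e1 : g.flux V φ e y = (∑ j, vectorComponents e V y j *
        Coord.partialDeriv j ((fun z => φ z ^ 2) ∘ e.symm) y) • vectorComponents e V y
        + (-((fun z => φ z ^ 2) ∘ e.symm) y) • ((fun k => ∑ j, vectorComponents e V y j *
          Coord.covDeriv (g.components e) (vectorComponents e V) j k y)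
          - (∑ j, Coord.covDeriv (g.components e) (vectorComponents e V) j j y)
            • vectorComponents e V y) := by
      funext k
      simp only [flux, Coord.energyFlux, Pi.add_apply, Pi.smul_apply, Pi.sub_apply, smul_eq_mul]
      ring
    rw [e1, Matrix.mulVec_add, Matrix.mulVec_smul, Matrix.mulVec_smul, Matrix.mulVec_sub,
      Matrix.mulVec_smul, ← ht y hy, ← h1, ← h2, ← h3, ← h4]
    funext k
    simp only [flux, Coord.energyFlux, Pi.add_apply, Pi.smul_apply, Pi.sub_apply, smul_eq_mul]
    ring

/-- The components of `f² ∇ψ - ψ ∇f²` with `ψ = φ²`. -/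
def wronskian (f φ : M → ℝ) (e : OpenPartialHomeomorph M (CoordSpace n)) (y : CoordSpace n)
    (k : Fin n) : ℝ :=
  f (e.symm y) ^ 2 * Coord.gradient (g.components e) ((fun z => φ z ^ 2) ∘ e.symm) y k
    + (-φ (e.symm y) ^ 2) * Coord.gradient (g.components e) ((fun z => f z ^ 2) ∘ e.symm) y k

theorem isVectorField_wronskian (hf : ContMDiff (𝓡 n) 𝓘(ℝ, ℝ) 2 f)
    (hφ : ContMDiff (𝓡 n) 𝓘(ℝ, ℝ) 2 φ) : IsVectorField (g.wronskian f φ) :=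
  ((g.isVectorField_gradient (hφ.pow 2)).smul (h := fun x => f x ^ 2)
    ((hf.pow 2).of_le (by norm_num))).add
  ((g.isVectorField_gradient (hf.pow 2)).smul (h := fun x => -φ x ^ 2)
    ((hφ.pow 2).neg.of_le (by norm_num)))

/-- Green's identity: the cross terms `∇f² · ∇φ²` cancel by symmetry of the inverse metric. It moves
`□` from `φ²` to `f²` in the second bound. -/
theorem divergenceOf_wronskian (hf : ContMDiff (𝓡 n) 𝓘(ℝ, ℝ) 2 f)
    (hφ : ContMDiff (𝓡 n) 𝓘(ℝ, ℝ) 2 φ) (x : M) :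
    g.divergenceOf (g.wronskian f φ) x = f x ^ 2 * g.dAlembertian (fun z => φ z ^ 2) x
      - φ x ^ 2 * g.dAlembertian (fun z => f z ^ 2) x := by
  have he := chart_mem_atlas (CoordSpace n) x
  have hx := mem_chart_source (CoordSpace n) x
  rw [← g.divergenceOf_gradient (hφ.pow 2), ← g.divergenceOf_gradient (hf.pow 2)]
  have h1 := g.isVectorField_gradient (hφ.pow 2)
  have h2 := g.isVectorField_gradient (hf.pow 2)
  unfold divergenceOf
  set e := chartAt (CoordSpace n) x
  have hy := e.map_source hx
  have hn := e.open_target.mem_nhds hy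
  have d1 := fun k => (h1.differentiableOn he k).differentiableAt hn
  have d2 := fun k => (h2.differentiableOn he k).differentiableAt hn
  have c1 := ((contDiffOn_comp_symm (k := 2) (hφ.pow 2) he).differentiableOn
    (by norm_num)).differentiableAt hn
  have c2 := ((contDiffOn_comp_symm (k := 2) (hf.pow 2) he).differentiableOn
    (by norm_num)).differentiableAt hn
  set G := g.components e
  set F := (fun z => φ z ^ 2) ∘ e.symm with hF
  set H := (fun z => f z ^ 2) ∘ e.symm with hH
  have hw : g.wronskian f φ e = fun y k => H y * Coord.gradient G F y k
      + (-F y) * Coord.gradient G H y k := by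
    funext y k
    simp [wronskian, hF, hH, G]
  have hcross : ∑ i, Coord.partialDeriv i H (e x) * Coord.gradient G F (e x) i
      = ∑ i, Coord.partialDeriv i F (e x) * Coord.gradient G H (e x) i := by
    simp only [Coord.gradient, Finset.mul_sum]
    rw [Finset.sum_comm]
    refine Finset.sum_congr rfl fun i _ => Finset.sum_congr rfl fun j _ => ?_
    rw [(g.isMetricOn_components he).inv_symm hy j i]
    ring
  have hneg : ∀ i, Coord.partialDeriv i (fun y => -F y) (e x) = -Coord.partialDeriv i F (e x) := by
    intro i
    simp [Coord.partialDeriv]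
  have hs : ∀ i, Coord.covDeriv G (g.wronskian f φ e) i i (e x)
      = (Coord.partialDeriv i H (e x) * Coord.gradient G F (e x) i
        + H (e x) * Coord.covDeriv G (Coord.gradient G F) i i (e x))
      + (-Coord.partialDeriv i F (e x) * Coord.gradient G H (e x) i
        + (-F (e x)) * Coord.covDeriv G (Coord.gradient G H) i i (e x)) := by
    intro i
    rw [hw, Coord.covDeriv_add G (fun k => c2.fun_mul (d1 k)) (fun k => c1.fun_neg.fun_mul (d2 k)),
      Coord.covDeriv_mul G c2 d1, Coord.covDeriv_mul G c1.fun_neg d2, hneg]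
  have hFx : F (e x) = φ x ^ 2 := by simp only [hF, Function.comp_apply, e.left_inv hx]
  have hHx : H (e x) = f x ^ 2 := by simp only [hH, Function.comp_apply, e.left_inv hx]
  rw [Finset.sum_congr rfl fun i _ => hs i]
  simp only [Finset.sum_add_distrib, neg_mul, Finset.sum_neg_distrib, ← Finset.mul_sum, hcross,
    hFx, hHx]
  ring

/-- The square `(∇φ)²` of the gradient at `x`. -/
def gradSq (φ : M → ℝ) (x : M) : ℝ :=
  Coord.gradSq (g.components (chartAt (CoordSpace n) x))
    (φ ∘ (chartAt (CoordSpace n) x).symm) (chartAt (CoordSpace n) x x)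

theorem dAlembertian_sq (hφ : ContMDiff (𝓡 n) 𝓘(ℝ, ℝ) 2 φ) (x : M) :
    g.dAlembertian (fun z => φ z ^ 2) x = 2 * φ x * g.dAlembertian φ x + 2 * g.gradSq φ x := by
  have h := (g.isMetricOn_components (chart_mem_atlas _ x)).dAlembertian_sq
    (OpenPartialHomeomorph.map_source _ (mem_chart_source _ x))
    (contDiffOn_comp_symm (k := 2) hφ (chart_mem_atlas _ x))
  rw [Function.comp_apply, OpenPartialHomeomorph.left_inv _ (mem_chart_source _ x)] at h
  exact h

theorem sum_components_mul_unit (hUunit : ∀ x, g.inner x (U x) (U x) = 1)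
    (he : e ∈ atlas (CoordSpace n) M) {y : CoordSpace n} (hy : y ∈ e.target) :
    ∑ i, ∑ j, g.components e y i j * vectorComponents e U y i * vectorComponents e U y j = 1 := by
  rw [← g.inner_eq_sum he hy, hUunit]

/-- The signature condition concerns some timelike vector at each point; `inner_self_nonpos`
transfers it to `U`, as the coordinate inequality requires. -/
theorem gradSq_le (hUunit : ∀ x, g.inner x (U x) (U x) = 1) (φ : M → ℝ) (x : M) :
    g.gradSq φ x ≤ directionalDeriv U φ x ^ 2 := by
  have he := chart_mem_atlas (CoordSpace n) x
  have hy := OpenPartialHomeomorph.map_source _ (mem_chart_source (CoordSpace n) x)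
  refine (g.isMetricOn_components he).gradSq_le hy _ _
    (g.sum_components_mul_unit hUunit he hy) fun w hw => ?_
  obtain ⟨u, hu, hu'⟩ := exists_mfderiv_symm_eq he hy U
  have h1 := g.inner_mfderiv_symm (e := chartAt (CoordSpace n) x) (chartAt (CoordSpace n) x x) u
    (WithLp.toLp 2 w)
  rw [hu] at h1
  simp only [hu'] at h1
  rw [hw] at h1
  refine (g.inner_mfderiv_symm (e := chartAt (CoordSpace n) x) (chartAt (CoordSpace n) x x)
    (WithLp.toLp 2 w) (WithLp.toLp 2 w)).symm.trans_le (g.inner_self_nonpos (u := U _) ?_ h1)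
  rw [hUunit]
  exact one_pos

/-- The effective energy density up to a divergence. -/
theorem effectiveEnergyDensity_mul_sq (hn : (n : ℝ) - 2 ≠ 0)
    (hUunit : ∀ x, g.inner x (U x) (U x) = 1) (m ξ : ℝ) (hφ : ContMDiff (𝓡 n) 𝓘(ℝ, ℝ) 2 φ)
    (hV : ∀ x, V x = f x • U x) (hV2 : IsC2VectorField V) (x : M) :
    g.effectiveEnergyDensity m ξ φ U x * f x ^ 2
      = directionalDeriv V φ x ^ 2 - m ^ 2 * φ x ^ 2 * f x ^ 2 / ((n : ℝ) - 2)
        - ξ / ((n : ℝ) - 2) * f x ^ 2 * g.dAlembertian (fun z => φ z ^ 2) x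
        - ξ * (g.divergenceOf (g.flux V φ) x
          - 4 * g.divergence V x * φ x * directionalDeriv V φ x
          + φ x ^ 2 * (g.covDerivTraceSq V x - g.divergence V x ^ 2)) := by
  have he := chart_mem_atlas (CoordSpace n) x
  have hx := mem_chart_source (CoordSpace n) x
  have hG := g.isMetricOn_components he
  unfold effectiveEnergyDensity energyDensity stressEnergyTrace directionalDeriv dAlembertian
    divergenceOf divergence covDerivTraceSq flux
  set e := chartAt (CoordSpace n) x
  have hy := e.map_source hx
  have hφe := contDiffOn_comp_symm (k := 2) hφ he
  have h1 := hG.effectiveEnergyDensity_eq hy hn m ξ (φ ∘ e.symm) (vectorComponents e U (e x))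
    (g.sum_components_mul_unit hUunit he hy)
  have h2 := hG.sum_covDeriv_energyFlux hy (hV2 e he)
    (contDiffOn_comp_symm (k := 2) (hφ.pow 2) he)
  have hφx : φ (e.symm (e x)) = φ x := by rw [e.left_inv hx]
  have hVU : ∀ i, vectorComponents e V (e x) i = f x * vectorComponents e U (e x) i := by
    intro i
    rw [vectorComponents_smul hV, e.left_inv hx]
  have hψ : ∀ j, Coord.partialDeriv j ((fun z => φ z ^ 2) ∘ e.symm) (e x)
      = 2 * φ x * Coord.partialDeriv j (φ ∘ e.symm) (e x) := by
    intro j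
    rw [← hφx]
    exact Coord.partialDeriv_pow_two ((hφe.differentiableOn (by norm_num)).differentiableAt
      (e.open_target.mem_nhds hy)) j
  have hVψ : ∑ j, vectorComponents e V (e x) j *
      Coord.partialDeriv j ((fun z => φ z ^ 2) ∘ e.symm) (e x)
      = 2 * φ x * ∑ j, vectorComponents e V (e x) j *
        Coord.partialDeriv j (φ ∘ e.symm) (e x) := by
    simp only [hψ, Finset.mul_sum]
    exact Finset.sum_congr rfl fun j _ => by ring
  -- Contractions with `U` twice absorb `f²` without differentiating `f`. All derivatives of `f` are
  -- thus hidden in `∇V`.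
  have hquad : ∀ S : Fin n → Fin n → ℝ,
      ∑ i, ∑ j, S i j * vectorComponents e V (e x) i * vectorComponents e V (e x) j
      = f x ^ 2 * ∑ i, ∑ j, S i j * vectorComponents e U (e x) i * vectorComponents e U (e x) j := by
    intro S
    simp only [hVU, Finset.mul_sum]
    exact Finset.sum_congr rfl fun i _ => Finset.sum_congr rfl fun j _ => by ring
  have hlin : ∑ j, vectorComponents e V (e x) j * Coord.partialDeriv j (φ ∘ e.symm) (e x)
      = f x * ∑ j, vectorComponents e U (e x) j * Coord.partialDeriv j (φ ∘ e.symm) (e x) := by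
    simp only [hVU, Finset.mul_sum, mul_assoc]
  rw [hVψ, hquad, hquad] at h2
  simp only [Function.comp_apply, hφx] at h2
  rw [h1, h2, hlin]
  simp only [Function.comp_apply, hφx]
  simp only [Function.comp_def]
  ring

end LorentzMetric

/-! ### Vanishing outside the support of `f`. -/

namespace LorentzMetric

variable {n : ℕ} {M : Type*} [TopologicalSpace M] [ChartedSpace (CoordSpace n) M]
  {V : ∀ x : M, TangentSpace (𝓡 n) x}

theorem vectorComponents_eq_zero (e : OpenPartialHomeomorph M (CoordSpace n)) {y : CoordSpace n}
    (h : V (e.symm y) = 0) : vectorComponents e V y = 0 := by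
  funext i
  unfold vectorComponents
  rw [h]
  exact congrArg (fun v : CoordSpace n => v i) (map_zero (mfderiv (𝓡 n) (𝓡 n) e (e.symm y)))

variable [IsManifold (𝓡 n) ∞ M] (g : LorentzMetric n M) {f : M → ℝ}

theorem covDerivTraceSq_eq_zero {K : Set M} (hK : IsClosed K) (hV : ∀ x ∉ K, V x = 0) {x : M}
    (hx : x ∉ K) : g.covDerivTraceSq V x = 0 := by
  have hxs := mem_chart_source (CoordSpace n) x
  unfold covDerivTraceSq
  set e := chartAt (CoordSpace n) x
  have ho : IsOpen (e.target ∩ e.symm ⁻¹' Kᶜ) := e.isOpen_inter_preimage_symm hK.isOpen_compl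
  have hz : ∀ z ∈ e.target ∩ e.symm ⁻¹' Kᶜ, vectorComponents e V z = fun _ => 0 := fun z hz =>
    vectorComponents_eq_zero e (hV _ hz.2)
  refine Finset.sum_eq_zero fun i _ => Finset.sum_eq_zero fun j _ => ?_
  rw [Coord.covDeriv_congr (Z := fun _ _ => 0) _ ho hz
    ⟨e.map_source hxs, by rwa [mem_preimage, e.left_inv hxs]⟩]
  simp [Coord.covDeriv, Coord.partialDeriv_const]

theorem gradient_comp_symm_eq_zero {K : Set M} (hK : IsClosed K) (hf : ∀ x ∉ K, f x = 0)
    (e : OpenPartialHomeomorph M (CoordSpace n)) {y : CoordSpace n} (hy : y ∈ e.target)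
    (hyK : e.symm y ∉ K) : Coord.gradient (g.components e) (f ∘ e.symm) y = 0 := by
  have ho : IsOpen (e.target ∩ e.symm ⁻¹' Kᶜ) := e.isOpen_inter_preimage_symm hK.isOpen_compl
  funext k
  refine Finset.sum_eq_zero fun j _ => ?_
  rw [Coord.partialDeriv_congr (F := f ∘ e.symm) (H := fun _ => 0) ho (fun z hz => hf _ hz.2) ⟨hy, hyK⟩,
    Coord.partialDeriv_const, mul_zero]

theorem flux_eq_zero {K : Set M} (hV : ∀ x ∉ K, V x = 0) (φ : M → ℝ)
    (e : OpenPartialHomeomorph M (CoordSpace n)) {y : CoordSpace n} (hyK : e.symm y ∉ K) :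
    g.flux V φ e y = 0 := by
  have h := vectorComponents_eq_zero e (hV _ hyK)
  funext k
  simp [flux, Coord.energyFlux, h]

theorem wronskian_eq_zero {K : Set M} (hK : IsClosed K) (hf : ∀ x ∉ K, f x = 0) (φ : M → ℝ)
    (e : OpenPartialHomeomorph M (CoordSpace n)) {y : CoordSpace n} (hy : y ∈ e.target)
    (hyK : e.symm y ∉ K) : g.wronskian f φ e y = 0 := by
  have h := g.gradient_comp_symm_eq_zero (f := fun z => f z ^ 2) hK
    (fun x hx => by rw [hf x hx]; ring) e hy hyK
  funext k
  simp [wronskian, h, hf _ hyK]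

end LorentzMetric

/-! ### The two integral bounds. -/

/-- Here `d` is a total divergence, so each bound reduces to the pointwise nonnegativity of `a + b -
d`. -/
theorem neg_integral_le_integral_of_integral_eq_zero {X : Type*} [MeasurableSpace X] {μ : Measure X}
    {a b d : X → ℝ} (ha : Integrable a μ) (hb : Integrable b μ) (hd : ∫ x, d x ∂μ = 0)
    (hle : ∀ x, d x ≤ a x + b x) (hdi : Integrable d μ) : -∫ x, b x ∂μ ≤ ∫ x, a x ∂μ := by
  have h := integral_mono hdi (ha.add hb) hle
  rw [hd, integral_add' ha hb] at h
  linarith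

end

theorem theorem2 {n : ℕ} (hn : 3 ≤ n) {M : Type*} [TopologicalSpace M] [T2Space M]
    [SecondCountableTopology M] [ChartedSpace (CoordSpace n) M] [IsManifold (𝓡 n) ∞ M]
    [MeasurableSpace M] [BorelSpace M] (g : LorentzMetric n M)
    (U : ∀ x : M, TangentSpace (𝓡 n) x)
    (hU : ContMDiff (𝓡 n) (𝓡 n).tangent 2 (fun x => (⟨x, U x⟩ : TangentBundle (𝓡 n) M)))
    (hUunit : ∀ x, g.inner x (U x) (U x) = 1)
    (m ξ : ℝ) (hξ : ξ ∈ Set.Icc (0 : ℝ) (((n : ℝ) - 3) / (2 * ((n : ℝ) - 2))))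
    (φ : M → ℝ) (hφ : ContMDiff (𝓡 n) 𝓘(ℝ, ℝ) 2 φ) (hφ_shell : g.IsOnShell m ξ φ)
    (f : M → ℝ) (hf : ContMDiff (𝓡 n) 𝓘(ℝ, ℝ) 2 f) (hf_supp : HasCompactSupport f)
    (V : ∀ x : M, TangentSpace (𝓡 n) x) (hV : ∀ x, V x = f x • U x)
    (b₁ b₂ : M → ℝ)
    (hb₁ : ∀ x, b₁ x =
      ((1 - 2 * ξ) / ((n : ℝ) - 2) * m ^ 2 * f x ^ 2
        - 2 * ξ ^ 2 * g.scalarCurvature x / ((n : ℝ) - 2) * f x ^ 2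
        + ξ * (g.divergence V x ^ 2 + g.covDerivTraceSq V x)) * φ x ^ 2)
    (hb₂ : ∀ x, b₂ x =
      (-((1 - 2 * ξ) / (2 * ((n : ℝ) - 2)) * g.dAlembertian (fun z => f z ^ 2) x)
        - ξ * g.scalarCurvature x / ((n : ℝ) - 2) * f x ^ 2
        + ξ * (g.divergence V x ^ 2 + g.covDerivTraceSq V x)) * φ x ^ 2) :
    Integrable (fun x => g.effectiveEnergyDensity m ξ φ U x * f x ^ 2) g.volumeMeasure ∧
    Integrable b₁ g.volumeMeasure ∧ Integrable b₂ g.volumeMeasure ∧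
    -min (∫ x, b₁ x ∂g.volumeMeasure) (∫ x, b₂ x ∂g.volumeMeasure) ≤
      ∫ x, g.effectiveEnergyDensity m ξ φ U x * f x ^ 2 ∂g.volumeMeasure := by
  have hn3 : (3 : ℝ) ≤ n := by exact_mod_cast hn
  obtain ⟨N, hN⟩ : ∃ N : ℝ, N = (n : ℝ) - 2 := ⟨_, rfl⟩
  have hN1 : 1 ≤ N := by linarith
  have hN0 : N ≠ 0 := by linarith
  have hn3' : (n : ℝ) - 3 = N - 1 := by rw [hN]; ring
  have := g.isLocallyFiniteMeasure_volumeMeasure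
  have hV2 := LorentzMetric.isC2VectorField_smul hV hU hf
  have hK : IsCompact (tsupport f) := hf_supp
  have hf0 : ∀ x ∉ tsupport f, f x = 0 := fun x hx => image_eq_zero_of_notMem_tsupport hx
  have hV0 : ∀ x ∉ tsupport f, V x = 0 := fun x hx => by rw [hV, hf0 x hx, zero_smul]
  have hφ2 : ContMDiff (𝓡 n) 𝓘(ℝ, ℝ) 2 (fun z => φ z ^ 2) := hφ.pow 2
  have hf2 : ContMDiff (𝓡 n) 𝓘(ℝ, ℝ) 2 (fun z => f z ^ 2) := hf.pow 2
  have cf := hf.continuous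
  have cφ := hφ.continuous
  have cB := g.continuous_dAlembertian hφ
  have cBφ := g.continuous_dAlembertian hφ2
  have cBf := g.continuous_dAlembertian hf2
  have cD := g.continuous_divergence hV2
  have cT := g.continuous_covDerivTraceSq hV2
  have cP := g.continuous_directionalDeriv hV2 hφ
  have hY := g.isVectorField_flux hV2 hφ
  have hX := g.isVectorField_wronskian hf hφ
  have cY := g.continuous_divergenceOf hY
  have cX := g.continuous_divergenceOf hX
  have hY0 : ∀ e ∈ atlas (CoordSpace n) M, ∀ y ∈ e.target, e.symm y ∉ tsupport f →
      g.flux V φ e y = 0 := fun e _ y _ h => g.flux_eq_zero hV0 φ e h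
  have hX0 : ∀ e ∈ atlas (CoordSpace n) M, ∀ y ∈ e.target, e.symm y ∉ tsupport f →
      g.wronskian f φ e y = 0 := fun e _ y hy h => g.wronskian_eq_zero hK.isClosed hf0 φ e hy h
  have iY := g.integral_divergenceOf hY hK hY0
  have iX := g.integral_divergenceOf hX hK hX0
  have zY : ∀ x ∉ tsupport f, g.divergenceOf (g.flux V φ) x = 0 := fun x hx =>
    g.divergenceOf_eq_zero hK.isClosed hY0 hx
  have zX : ∀ x ∉ tsupport f, g.divergenceOf (g.wronskian f φ) x = 0 := fun x hx =>
    g.divergenceOf_eq_zero hK.isClosed hX0 hx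
  have zD : ∀ x ∉ tsupport f, g.divergence V x = 0 := fun x hx =>
    g.divergenceOf_eq_zero hK.isClosed
      (fun e _ y _ h => LorentzMetric.vectorComponents_eq_zero e (hV0 _ h)) hx
  have zT : ∀ x ∉ tsupport f, g.covDerivTraceSq V x = 0 := fun x hx =>
    g.covDerivTraceSq_eq_zero hK.isClosed hV0 hx
  have zBf : ∀ x ∉ tsupport f, g.dAlembertian (fun z => f z ^ 2) x = 0 := by
    intro x hx
    rw [← g.divergenceOf_gradient hf2]
    exact g.divergenceOf_eq_zero hK.isClosed (fun e _ y hy h => g.gradient_comp_symm_eq_zero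
      hK.isClosed (fun x hx => by rw [hf0 x hx]; ring) e hy h) hx
  -- The only use of the field equation. It removes `R` from both integrands, so they become visibly
  -- continuous.
  have hR : ∀ x, ξ * g.scalarCurvature x * φ x = -g.dAlembertian φ x - m ^ 2 * φ x := fun x => by
    linear_combination hφ_shell x
  have hρ := g.effectiveEnergyDensity_mul_sq (hN ▸ hN0) hUunit m ξ hφ hV hV2
  have hb₁' : ∀ x, b₁ x = (1 - 2 * ξ) / N * m ^ 2 * f x ^ 2 * φ x ^ 2
      + 2 * ξ / N * f x ^ 2 * φ x * (g.dAlembertian φ x + m ^ 2 * φ x)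
      + ξ * (g.divergence V x ^ 2 + g.covDerivTraceSq V x) * φ x ^ 2 := by
    intro x
    rw [hb₁, ← hN]
    linear_combination (-2 * ξ / N * f x ^ 2 * φ x) * hR x
  have hb₂' : ∀ x, b₂ x = -((1 - 2 * ξ) / (2 * N) * g.dAlembertian (fun z => f z ^ 2) x) * φ x ^ 2
      + 1 / N * f x ^ 2 * φ x * (g.dAlembertian φ x + m ^ 2 * φ x)
      + ξ * (g.divergence V x ^ 2 + g.covDerivTraceSq V x) * φ x ^ 2 := by
    intro x
    rw [hb₂, ← hN]
    linear_combination (-1 / N * f x ^ 2 * φ x) * hR x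
  rw [← hN] at hρ
  rw [← hN, hn3'] at hξ
  obtain ⟨hξ0, hξ1⟩ := hξ
  -- This is the condition `ξ ≤ ξ_v`, solved for `1 - 2ξ`.
  have hξ2 : 1 / N ≤ 1 - 2 * ξ := by
    rw [le_div_iff₀ (by positivity)] at hξ1
    rw [div_le_iff₀ (by positivity)]
    linarith
  -- Follows from the previous bound, since `2ξ ≤ 1`.
  have hξ3 : 2 * ξ / N ≤ 1 - 2 * ξ := by
    refine le_trans ?_ hξ2
    have : 0 ≤ 1 / N := by positivity
    gcongr
    linarith
  have integrable_of_continuous : ∀ h : M → ℝ, Continuous h → (∀ x ∉ tsupport f, h x = 0) →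
      Integrable h g.volumeMeasure := fun h hc h0 =>
    hc.integrable_of_hasCompactSupport (HasCompactSupport.intro hK h0)
  have Iρ : Integrable (fun x => g.effectiveEnergyDensity m ξ φ U x * f x ^ 2)
      g.volumeMeasure := by
    refine integrable_of_continuous _ ?_ fun x hx => by rw [hf0 x hx]; ring
    -- Continuity of `ρf²` is read off from the pointwise formula, whose curvature terms are
    -- contained in the continuous function `div Y`.
    simp only [hρ]
    fun_prop
  have I₁ : Integrable b₁ g.volumeMeasure := by
    refine integrable_of_continuous _ ?_ fun x hx => by
      rw [hb₁', hf0 x hx, zD x hx, zT x hx]; ring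
    simp only [funext hb₁']
    fun_prop
  have I₂ : Integrable b₂ g.volumeMeasure := by
    refine integrable_of_continuous _ ?_ fun x hx => by
      rw [hb₂', hf0 x hx, zD x hx, zT x hx, zBf x hx]; ring
    simp only [funext hb₂']
    fun_prop
  have IY := integrable_of_continuous _ cY zY
  have IX := integrable_of_continuous _ cX zX
  -- The kinetic bracket is nonnegative, by `f²(∇φ)² ≤ f²(Uφ)² = (Vφ)²`. It is used with `c = 2ξ/N`
  -- for the first bound and `c = 1/N` for the second.
  have hQ : ∀ x, ∀ c : ℝ, 0 ≤ c → c ≤ 1 - 2 * ξ →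
      c * (f x ^ 2 * g.gradSq φ x) ≤ (1 - 2 * ξ) * LorentzMetric.directionalDeriv V φ x ^ 2 := by
    intro x c hc hc'
    have h1 := mul_le_mul_of_nonneg_left (g.gradSq_le hUunit φ x) (sq_nonneg (f x))
    rw [LorentzMetric.directionalDeriv_smul hV, mul_pow]
    exact (mul_le_mul_of_nonneg_left h1 hc).trans
      (mul_le_mul_of_nonneg_right hc' (mul_nonneg (sq_nonneg _) (sq_nonneg _)))
  have hsq : ∀ x, 0 ≤ 2 * ξ *
      (LorentzMetric.directionalDeriv V φ x + φ x * g.divergence V x) ^ 2 := fun x => by positivity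
  have B₁ : -∫ x, b₁ x ∂g.volumeMeasure
      ≤ ∫ x, g.effectiveEnergyDensity m ξ φ U x * f x ^ 2 ∂g.volumeMeasure := by
    refine neg_integral_le_integral_of_integral_eq_zero (d := fun x => -ξ * g.divergenceOf (g.flux V φ) x)
      Iρ I₁ ?_ (fun x => ?_) (IY.const_mul _)
    · rw [integral_const_mul, iY, mul_zero]
    · rw [hρ, hb₁', g.dAlembertian_sq hφ]
      have h1 := hQ x (2 * ξ / N) (by positivity) hξ3
      have h2 := hsq x
      -- Moving `2ξ(Vφ)²` out of `(Vφ)²` completes the square with the cross term `4ξ φ (div V)(Vφ)`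
      -- and the two copies of `ξφ²(div V)²`. The mass terms cancel, as `(1-2ξ)/N + 2ξ/N = 1/N`.
      have h3 : LorentzMetric.directionalDeriv V φ x ^ 2 - m ^ 2 * φ x ^ 2 * f x ^ 2 / N
          - ξ / N * f x ^ 2 * (2 * φ x * g.dAlembertian φ x + 2 * g.gradSq φ x)
          - ξ * (g.divergenceOf (g.flux V φ) x
            - 4 * g.divergence V x * φ x * LorentzMetric.directionalDeriv V φ x
            + φ x ^ 2 * (g.covDerivTraceSq V x - g.divergence V x ^ 2))
          + ((1 - 2 * ξ) / N * m ^ 2 * f x ^ 2 * φ x ^ 2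
            + 2 * ξ / N * f x ^ 2 * φ x * (g.dAlembertian φ x + m ^ 2 * φ x)
            + ξ * (g.divergence V x ^ 2 + g.covDerivTraceSq V x) * φ x ^ 2)
          = -ξ * g.divergenceOf (g.flux V φ) x
            + ((1 - 2 * ξ) * LorentzMetric.directionalDeriv V φ x ^ 2
              - 2 * ξ / N * (f x ^ 2 * g.gradSq φ x))
            + 2 * ξ * (LorentzMetric.directionalDeriv V φ x + φ x * g.divergence V x) ^ 2 := by
        field_simp
        ring
      rw [h3]
      linarith
  have B₂ : -∫ x, b₂ x ∂g.volumeMeasure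
      ≤ ∫ x, g.effectiveEnergyDensity m ξ φ U x * f x ^ 2 ∂g.volumeMeasure := by
    refine neg_integral_le_integral_of_integral_eq_zero (d := fun x => -ξ * g.divergenceOf (g.flux V φ) x
      + (1 - 2 * ξ) / (2 * N) * g.divergenceOf (g.wronskian f φ) x)
      Iρ I₂ ?_ (fun x => ?_) ((IY.const_mul _).add (IX.const_mul _))
    · rw [integral_add (IY.const_mul _) (IX.const_mul _), integral_const_mul, integral_const_mul,
        iY, iX, mul_zero, mul_zero, add_zero]
    · rw [hρ, hb₂', g.divergenceOf_wronskian hf hφ, g.dAlembertian_sq hφ]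
      have h1 := hQ x (1 / N) (by positivity) hξ2
      have h2 := hsq x
      -- The coefficient `(1-2ξ)/(2N)` of `div X` cancels the `□f²` term of `b₂` and turns `-(ξ/N)
      -- f²□φ²` into `-(1/(2N)) f²□φ²`. The `φ□φ` part of the latter cancels against the
      -- field-equation term of `b₂`.
      have h3 : LorentzMetric.directionalDeriv V φ x ^ 2 - m ^ 2 * φ x ^ 2 * f x ^ 2 / N
          - ξ / N * f x ^ 2 * (2 * φ x * g.dAlembertian φ x + 2 * g.gradSq φ x)
          - ξ * (g.divergenceOf (g.flux V φ) x
            - 4 * g.divergence V x * φ x * LorentzMetric.directionalDeriv V φ x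
            + φ x ^ 2 * (g.covDerivTraceSq V x - g.divergence V x ^ 2))
          + (-((1 - 2 * ξ) / (2 * N) * g.dAlembertian (fun z => f z ^ 2) x) * φ x ^ 2
            + 1 / N * f x ^ 2 * φ x * (g.dAlembertian φ x + m ^ 2 * φ x)
            + ξ * (g.divergence V x ^ 2 + g.covDerivTraceSq V x) * φ x ^ 2)
          = -ξ * g.divergenceOf (g.flux V φ) x + (1 - 2 * ξ) / (2 * N)
              * (f x ^ 2 * (2 * φ x * g.dAlembertian φ x + 2 * g.gradSq φ x)
                - φ x ^ 2 * g.dAlembertian (fun z => f z ^ 2) x)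
            + ((1 - 2 * ξ) * LorentzMetric.directionalDeriv V φ x ^ 2
              - 1 / N * (f x ^ 2 * g.gradSq φ x))
            + 2 * ξ * (LorentzMetric.directionalDeriv V φ x + φ x * g.divergence V x) ^ 2 := by
        field_simp
        ring
      rw [h3]
      linarith
  refine ⟨Iρ, I₁, I₂, ?_⟩
  rw [neg_le]
  exact le_min (neg_le.1 B₁) (neg_le.1 B₂)
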